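/- **Theorem (Swap regret upper bounds).** There is an absolute constant $K>0$ such that the following holds. Let $n\ge 2$ and $T\ge 2$. Consider an $n$-player general-sum game in which player $i$ has $m_i\ge 1$ actions (action set $\mathcal A_i$) and a utility function $u_i:\mathcal A_1\times\dots\times\mathcal A_n\to[-1,1]$, and put $m=\max_i m_i$. The game is played for $T$ rounds. In round $t$ a prescribed algorithm suggests a mixed strategy $\hat x_i^{(t)}\in\Delta_{m_i}$ to each player $i$; player $i$ plays some $x_i^{(t)}\in\Delta_{m_i}$, has the expected utility vector $u_i^{(t)}(a_i)=\mathbb E_{a_{-i}\sim x_{-i}^{(t)}}[u_i(a_i,a_{-i})]$, and observes some vector $\tilde u_i^{(t)}\in[-1,1]^{m_i}$. Assume corruption levels $$\sum_{t=1}^T\|x_i^{(t)}-\hat x_i^{(t)}\|_1\le\hat C_i,\qquad \sum_{t=1}^T\|u_i^{(t)}-\tilde u_i^{(t)}\|_\infty\le\tilde C_i\qquad(i\in[n]),$$ and put $C_i=2\hat C_i+2\tilde C_i$, $\hat S=\sum_i\hat C_i$, $\tilde S=\sum_i\tilde C_i$. *Algorithm.* For each player $i$ and each expert $a\in\mathcal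 A_i$ let $\tilde u_{i,a}^{(t)}=\hat x_i^{(t)}(a)\,\tilde u_i^{(t)}$ for $t\ge1$ and $\tilde u_{i,a}^{(0)}=0$. In round $t$ expert $a$ computes $$y_{i,a}^{(t)}=\operatorname*{arg\,max}_{y\in\Delta_{m_i}}\Big\{\Big\langle y,\ \tilde u_{i,a}^{(t-1)}+\sum_{s=1}^{t-1}\tilde u_{i,a}^{(s)}\Big\rangle-\frac{\phi(y)}{\eta_{i,a}^{(t)}}\Big\},\qquad \phi(y)=-\sum_k\log y(k),$$ $$\eta_{i,a}^{(t)}=\min\Big\{\sqrt{\frac{m_i\log T/8}{4+\sum_{s=1}^{t-1}\|\tilde u_{i,a}^{(s)}-\tilde u_{i,a}^{(s-1)}\|_\infty^2}},\ \frac1{256\,n\sqrt{m_i}}\Big\},$$ $Q_i^{(t)}$ is the row stochastic matrix with rows $y_{i,a}^{(t)}$, and $\hat x_i^{(t)}\in\Delta_{m_i}$ is a stationary distribution, $(Q_i^{(t)})^\top\hat x_i^{(t)}=\hat x_i^{(t)}$. For utility vectors $v=(v^{(1)},\dots,v^{(T)})$ let $\mathsf{SwapReg}_{x_i,v}^T=\max_M\sum_{t=1}^T\langle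 x_i^{(t)},Mv^{(t)}-v^{(t)}\rangle$, the maximum being over all $m_i\times m_i$ row stochastic matrices $M$. Then, for every player $i$, $$\mathsf{SwapReg}_{x_i,u_i}^T\le K\Big(n m^{5/2}\log T+\min\Big\{m\sqrt{\big(\hat S(n+\sqrt m)+\tilde S\sqrt m\big)\log T},\ m_i\sqrt{T\log T}\Big\}+C_i\Big),$$ $$\mathsf{SwapReg}_{x_i,\tilde u_i}^T\le K\Big(n m^{5/2}\log T+\min\Big\{m\sqrt{\big(\hat S(n+\sqrt m)+\tilde C_i\big)\log T}+\big(\tilde S\,n\,m^{7}(\log T)^3\big)^{1/4},\ m_i\sqrt{T\log T}\Big\}+\hat C_i\Big).$$ -/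

import Mathlib

open Finset Matrix

noncomputable section

namespace SwapRegretGames

/-! ### Vectors, swap regret -/

/-- The `ℓ₁` norm of a real vector.  (The `ℓ_∞` norm is the norm `‖·‖` of `Fin d → ℝ`.) -/
def l1norm {d : ℕ} (v : Fin d → ℝ) : ℝ := ∑ a, |v a|

/-- `SwapReg_{x,u}^T(M) = ∑_{t=1}^T ⟨x^t, M u^t - u^t⟩` for utilities `u`. -/
def swapRegretAt {d : ℕ} (T : ℕ) (x u : ℕ → Fin d → ℝ) (M : Matrix (Fin d) (Fin d) ℝ) : ℝ :=
  ∑ t ∈ Icc 1 T, x t ⬝ᵥ (M *ᵥ u t - u t)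

/-- `SwapReg_{x,u}^T`: the maximum of `SwapReg_{x,u}^T(M)` over all row stochastic matrices `M`
(it is attained, see `isGreatest_swapRegret`). -/
def swapRegret {d : ℕ} (T : ℕ) (x u : ℕ → Fin d → ℝ) : ℝ :=
  sSup (swapRegretAt T x u '' (rowStochastic ℝ (Fin d) : Set (Matrix (Fin d) (Fin d) ℝ)))

theorem isCompact_rowStochastic (d : ℕ) :
    IsCompact (rowStochastic ℝ (Fin d) : Set (Matrix (Fin d) (Fin d) ℝ)) := by
  have h : (rowStochastic ℝ (Fin d) : Set (Matrix (Fin d) (Fin d) ℝ)) =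
      Set.pi Set.univ (fun _ : Fin d => stdSimplex ℝ (Fin d)) := by
    ext M
    rw [SetLike.mem_coe, mem_rowStochastic_iff_sum]
    exact ⟨fun h i _ => ⟨h.1 i, h.2 i⟩,
      fun h => ⟨fun i => (h i trivial).1, fun i => (h i trivial).2⟩⟩
  rw [h]
  exact isCompact_univ_pi fun _ => isCompact_stdSimplex ℝ (Fin d)

theorem isGreatest_swapRegret {d : ℕ} (T : ℕ) (x u : ℕ → Fin d → ℝ) :
    IsGreatest
      (swapRegretAt T x u '' (rowStochastic ℝ (Fin d) : Set (Matrix (Fin d) (Fin d) ℝ)))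
      (swapRegret T x u) := by
  refine IsCompact.isGreatest_sSup ((isCompact_rowStochastic d).image ?_)
    ⟨_, Set.mem_image_of_mem _ (one_mem (rowStochastic ℝ (Fin d)))⟩
  unfold swapRegretAt
  fun_prop

/-! ### The game -/

/-- The expected utility vector of player `i`: `expectedUtility u x i a` is the expectation of
`u i (a, b_{-i})` when the actions `b_j`, `j ≠ i`, are drawn independently from `x j`.  The sum
runs over the action profiles `b` whose `i`-th entry is `a`. -/
def expectedUtility {n : ℕ} {m : Fin n → ℕ} (u : Fin n → (∀ j, Fin (m j)) → ℝ)
    (x : ∀ j, Fin (m j) → ℝ) (i : Fin n) : Fin (m i) → ℝ :=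
  fun a => ∑ b : ∀ j, Fin (m j) with b i = a, (∏ j ∈ univ.erase i, x j (b j)) * u i b

/-- The sequence of expected utility vectors `u_i^1, u_i^2, …` of player `i` when each player `j`
plays the mixed strategies `x j 1, x j 2, …`. -/
def expectedUtilities {n : ℕ} {m : Fin n → ℕ} (u : Fin n → (∀ j, Fin (m j)) → ℝ)
    (x : ∀ i, ℕ → Fin (m i) → ℝ) (i : Fin n) : ℕ → Fin (m i) → ℝ :=
  fun t => expectedUtility u (fun j => x j t) i

/-! ### The algorithm of one player

The player has `d` actions, there are `n` players and `T` rounds; `util t` is the utility vector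
observed in round `t` and `xhat t` the strategy suggested in round `t`, for `1 ≤ t ≤ T`. -/

/-- The utility vector `xhat^t(a) • util^t` handed to expert `a` at the end of round `t`; it is `0`
for `t = 0`. -/
def expertUtility {d : ℕ} (xhat util : ℕ → Fin d → ℝ) (a : Fin d) (t : ℕ) : Fin d → ℝ :=
  if t = 0 then 0 else xhat t a • util t

/-- The adaptive learning rate in round `t` of an expert that receives the utilities `w`:
`min {√((d log T / 8) / (4 + ∑_{s=1}^{t-1} ‖w^s - w^{s-1}‖_∞²)), 1 / (256 n √d)}`. -/
def learningRate (n T : ℕ) {d : ℕ} (w : ℕ → Fin d → ℝ) (t : ℕ) : ℝ :=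
  min (√((d * Real.log T / 8) / (4 + ∑ s ∈ Ico 1 t, ‖w s - w (s - 1)‖ ^ 2)))
    (1 / (256 * n * √d))

/-- The logarithmic barrier (on vectors with positive entries). -/
def logBarrier {d : ℕ} (y : Fin d → ℝ) : ℝ := -∑ k, Real.log (y k)

/-- The points of the simplex at which the logarithmic barrier is finite. -/
def posSimplex (d : ℕ) : Set (Fin d → ℝ) := {y | y ∈ stdSimplex ℝ (Fin d) ∧ ∀ k, 0 < y k}

/-- The objective that optimistic FTRL maximizes in round `t`:
`⟨y, w^{t-1} + ∑_{s=1}^{t-1} w^s⟩ - φ(y) / η^t`. -/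
def oftrlObjective (n T : ℕ) {d : ℕ} (w : ℕ → Fin d → ℝ) (t : ℕ) (y : Fin d → ℝ) : ℝ :=
  y ⬝ᵥ (w (t - 1) + ∑ s ∈ Ico 1 t, w s) - logBarrier y / learningRate n T w t

/-- `y` is the output of optimistic FTRL with logarithmic barrier in round `t`, i.e. the maximizer
of the objective over the simplex.  The barrier is `+∞` at points with a zero entry, so only points
with positive entries compete. -/
def IsOFTRLOutput (n T : ℕ) {d : ℕ} (w : ℕ → Fin d → ℝ) (t : ℕ) (y : Fin d → ℝ) : Prop :=
  y ∈ posSimplex d ∧ IsMaxOn (oftrlObjective n T w t) (posSimplex d) y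

/-- `xhat^1, …, xhat^T` are the strategies suggested by the Blum–Mansour reduction with one
log-barrier optimistic FTRL expert per action, when `util^1, …, util^T` are the observed utilities.
In each round expert `a` outputs `Q^t(a, ·)`, and `xhat^t` is a stationary distribution of the
row stochastic matrix `Q^t`. -/
def IsAlgorithmOutput (n T : ℕ) {d : ℕ} (util xhat : ℕ → Fin d → ℝ) : Prop :=
  ∃ Q : ℕ → Matrix (Fin d) (Fin d) ℝ, ∀ t ∈ Icc 1 T,
    (∀ a, IsOFTRLOutput n T (expertUtility xhat util a) t (Q t a)) ∧
    xhat t ∈ stdSimplex ℝ (Fin d) ∧ (Q t)ᵀ *ᵥ xhat t = xhat t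

/-! ### The corrupted regime -/

/-- All players are in the corrupted regime with corruption level `(Chat i, Ctil i)`.  In round
`t`, `xhat i t` is the strategy suggested to player `i` by the algorithm (run on the utilities
observed by player `i`), `x i t` is the strategy that player `i` plays, and `util i t` is the
utility vector observed by player `i`, which may differ from the expected utility vector. -/
structure IsCorruptedPlay {n : ℕ} {m : Fin n → ℕ} (T : ℕ) (u : Fin n → (∀ j, Fin (m j)) → ℝ)
    (xhat x util : ∀ i, ℕ → Fin (m i) → ℝ) (Chat Ctil : Fin n → ℝ) : Prop where
  algorithm : ∀ i, IsAlgorithmOutput n T (util i) (xhat i)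
  strategy_mem : ∀ i, ∀ t ∈ Icc 1 T, x i t ∈ stdSimplex ℝ (Fin (m i))
  util_mem : ∀ i, ∀ t ∈ Icc 1 T, ∀ a, util i t a ∈ Set.Icc (-1 : ℝ) 1
  strategy_corruption : ∀ i, ∑ t ∈ Icc 1 T, l1norm (x i t - xhat i t) ≤ Chat i
  utility_corruption : ∀ i,
    ∑ t ∈ Icc 1 T, ‖expectedUtilities u x i t - util i t‖ ≤ Ctil i

/-- The largest number of actions of a player. -/
def maxActions {n : ℕ} (m : Fin n → ℕ) : ℕ := univ.sup m

end SwapRegretGames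

end

/-!
The proof combines three bounds and a self-bounding argument.

*Regret of an expert.* For optimistic FTRL with logarithmic barrier `φ` and learning rates `η^t`,
the regret is at most `d log T / η^{T+1}` plus `4 ∑ η^t ‖w^t - w^{t-1}‖²`, minus
`1 / (2 η^t)` times the Bregman divergences of `φ` along the path `g^t → y^t → g^{t+1}`, where `y^t`
are the outputs and `g^t` the leaders computed without the optimistic prediction
(`oftrl_regret_le`). Since the path runs through the `g^t`, the change of the learning rate between
rounds does no harm. The adaptive choice of `η^t` turns the first two terms into
`√(d log T ∑ ‖w^t - w^{t-1}‖²) + n d^{3/2} log T` (`expert_regret_le`).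

*From rows to stationary distributions.* If each row `a` of a positive stochastic matrix changes by
factors in `[exp (-δ a), exp (δ a)]`, the stationary distribution moves by at most `4 ∑ a, δ a` in
`ℓ₁` (`IsPositiveChain.sum_abs_sub_le`). The rows are changed one at a time, which makes the
Markov chain tree theorem unnecessary. As the divergence of `φ` controls the squares of
logarithmic ratios, the negative terms of the experts control the path length
`X_i = ∑ ‖xhat_i^t - xhat_i^{t-1}‖₁²`. Summing over the experts, the swap regret of player `i`
with `d` actions is at most
`300 n d^{5/2} log T + 6 d √(P_i log T) - (n / (2 √d)) X_i`, where `P_i` is the total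
variation of the utilities of the experts (`swapRegretAt_le'`). As `P_i ≤ 4 T`, this already gives
the bound with `√(T log T)`.

*Variation of the utilities.* Expected utilities are Lipschitz in the strategies, so
`P_i ≲ 1 + n ∑ j, X_j + n ∑ j, Chat j + Ctil i` (`IsCorruptedPlay.expertVariation_le`).

*Self-bounding.* Swap regret is nonnegative, hence so is the sum over the players of these
upper bounds, weighted by the square roots of the numbers of actions. Solving the resulting
quadratic inequality for `y = √(n ∑ j, X_j)` gives
`y ≲ n m^{3/2} √(log T) + √(n ∑ j, Chat j) + √(m^{3/2} √(log T) √(n ∑ j, Ctil j))`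
(`IsCorruptedPlay.sqrt_pathLength_le`). Inserting this into the bound for a single player yields
both claims: the last term of `y` becomes the fourth root in the second bound, and in the first bound
it is dominated by the other terms. Finally, passing from `xhat` to `x` and from the observed to
the expected utilities costs `2 Chat i` and `2 Ctil i`.
-/

noncomputable section

namespace SwapRegretGames

/-! ### Stationary distributions of positive stochastic matrices -/

section Stationary

variable {ι : Type*} [Fintype ι]

/-- `π` is a stationary distribution of the row stochastic matrix `Q`, all of whose entries are
positive. -/
structure IsPositiveChain (Q : Matrix ι ι ℝ) (π : ι → ℝ) : Prop where
  pos : ∀ a b, 0 < Q a b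
  row_sum : ∀ a, ∑ b, Q a b = 1
  mem : π ∈ stdSimplex ℝ ι
  stationary : ∀ b, ∑ a, π a * Q a b = π b

theorem IsPositiveChain.pi_pos {Q : Matrix ι ι ℝ} {π : ι → ℝ} (h : IsPositiveChain Q π) (v : ι) :
    0 < π v := by
  rw [← h.stationary v]
  have h0 : 0 < ∑ a, π a := by rw [h.mem.2]; exact one_pos
  obtain ⟨a, ha, hpos⟩ := Finset.exists_lt_of_sum_lt (s := univ) (f := fun _ : ι => (0 : ℝ))
    (g := π) (by simpa using h0)
  exact Finset.sum_pos' (fun b _ => mul_nonneg (h.mem.1 b) (h.pos b v).le)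
    ⟨a, ha, mul_pos hpos (h.pos a v)⟩

theorem exists_isPositiveChain [DecidableEq ι] [Nonempty ι] {Q : Matrix ι ι ℝ}
    (hpos : ∀ a b, 0 < Q a b) (hrow : ∀ a, ∑ b, Q a b = 1) : ∃ π, IsPositiveChain Q π := by
  have hdet : (1 - Q).det = 0 := by
    rw [← Matrix.exists_mulVec_eq_zero_iff]
    refine ⟨fun _ => 1, fun h => one_ne_zero (congrFun h (Classical.arbitrary ι)), ?_⟩
    rw [sub_mulVec, one_mulVec, sub_eq_zero]
    ext a
    simp [mulVec, dotProduct, hrow]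
  obtain ⟨p, hp0, hp⟩ := Matrix.exists_vecMul_eq_zero_iff.2 hdet
  have hp' : ∀ b, ∑ a, p a * Q a b = p b := by
    intro b
    rw [vecMul_sub, vecMul_one, sub_eq_zero] at hp
    exact (congrFun hp b).symm
  have hle : ∀ b, |p b| ≤ ∑ a, |p a| * Q a b := by
    intro b
    rw [← hp' b]
    refine (abs_sum_le_sum_abs _ _).trans (le_of_eq (sum_congr rfl fun a _ => ?_))
    rw [abs_mul, abs_of_pos (hpos a b)]
  have htot : ∑ b, ∑ a, |p a| * Q a b = ∑ b, |p b| := by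
    rw [sum_comm]
    simp [← mul_sum, hrow]
  -- Passing to `|p|` can only increase the mass of `p Q`, but `Q` preserves the total mass.
  have heq : ∀ b, |p b| = ∑ a, |p a| * Q a b := fun b =>
    (sum_eq_sum_iff_of_le fun b _ => hle b).1 htot.symm b (mem_univ b)
  have hS : 0 < ∑ a, |p a| := by
    obtain ⟨a, ha⟩ := Function.ne_iff.1 hp0
    exact sum_pos' (fun _ _ => abs_nonneg _) ⟨a, mem_univ a, abs_pos.2 ha⟩
  refine ⟨fun a => |p a| / ∑ a, |p a|, hpos, hrow, ⟨fun a => by positivity, ?_⟩, fun b => ?_⟩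
  · rw [← sum_div, div_self hS.ne']
  · simp only [div_mul_eq_mul_div]
    rw [← sum_div, ← heq b]

/-- Changing a single row `v` by factors in `[1/c, c]` changes the ratios `π a / π v` by factors
at most `c`: `π a / π v` is the expected number of visits to `a` between two visits to `v`, and is
therefore a linear function of row `v` with nonnegative coefficients. The proof replaces the
probabilistic argument by a minimum principle. -/
theorem IsPositiveChain.cross_le {Q Q' : Matrix ι ι ℝ} {π π' : ι → ℝ} (h : IsPositiveChain Q π)
    (h' : IsPositiveChain Q' π') {v : ι} (hne : ∀ a, a ≠ v → Q' a = Q a) {c : ℝ} (hc : 1 ≤ c)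
    (hQ : ∀ b, Q' v b ≤ c * Q v b) (a : ι) : π v * π' a ≤ c * π' v * π a := by
  classical
  set ν : ι → ℝ := fun a => c * π' v * π a - π v * π' a with hν
  have hv := h.pi_pos v
  have hv' := h'.pi_pos v
  have hstat : ∀ a, ν a = ∑ b, ν b * Q b a + π v * π' v * (Q v a - Q' v a) := by
    intro a
    have e1 : ∑ b, ν b * Q b a = c * π' v * ∑ b, π b * Q b a - π v * ∑ b, π' b * Q b a := by
      simp only [hν, mul_sum, ← sum_sub_distrib]
      exact sum_congr rfl fun b _ => by ring
    have e2 : ∑ b, π' b * Q b a - ∑ b, π' b * Q' b a = π' v * (Q v a - Q' v a) := by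
      rw [← sum_sub_distrib, sum_eq_single v]
      · ring
      · intro b _ hb
        rw [hne b hb, sub_self]
      · simp
    rw [e1, h.stationary]
    rw [h'.stationary] at e2
    simp only [hν]
    linear_combination (π v) * e2
  set neg : ι → ℝ := fun a => max (-ν a) 0 with hneg
  have hneg0 : ∀ a, 0 ≤ neg a := fun a => le_max_right _ _
  have hnegv : neg v = 0 := by
    have : 0 ≤ ν v := by
      simp only [hν]
      nlinarith [mul_pos hv hv']
    simp only [hneg]
    exact max_eq_right (by linarith)
  have hle : ∀ a, neg a ≤ ∑ b, neg b * Q b a := by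
    intro a
    refine max_le ?_ (sum_nonneg fun b _ => mul_nonneg (hneg0 b) (h.pos b a).le)
    have e1 : ∀ b, -(ν b * Q b a) - (if b = v then -(ν v * Q v a) else 0) ≤ neg b * Q b a := by
      intro b
      by_cases hb : b = v
      · subst hb
        simp [hnegv]
      · simp only [if_neg hb, sub_zero]
        rw [← neg_mul]
        exact mul_le_mul_of_nonneg_right (le_max_left _ _) (h.pos b a).le
    have e2 := sum_le_sum fun b (_ : b ∈ univ) => e1 b
    rw [sum_sub_distrib, sum_neg_distrib, sum_ite_eq' univ v, if_pos (mem_univ v)] at e2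
    have e3 : ν v * Q v a + π v * π' v * (Q v a - Q' v a)
        = π v * π' v * (c * Q v a - Q' v a) := by
      simp only [hν]; ring
    have e4 : 0 ≤ π v * π' v * (c * Q v a - Q' v a) :=
      mul_nonneg (mul_pos hv hv').le (sub_nonneg.2 (hQ a))
    rw [hstat a]
    linarith
  -- Mass leaks from `neg` through state `v`, so `neg` vanishes.
  have hsum : ∑ b, neg b * Q b v ≤ 0 := by
    have e1 : ∑ a, neg a ≤ ∑ a, (∑ b, neg b * Q b a - if a = v then ∑ b, neg b * Q b v else 0) := by
      refine sum_le_sum fun a _ => ?_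
      by_cases ha : a = v
      · subst ha; simp [hnegv]
      · simpa [ha] using hle a
    rw [sum_sub_distrib, sum_ite_eq' univ v, if_pos (mem_univ v), sum_comm] at e1
    simp only [← mul_sum, h.row_sum, mul_one] at e1
    linarith
  have hzero := (sum_eq_zero_iff_of_nonneg
    (fun b _ => mul_nonneg (hneg0 b) (h.pos b v).le)).1
      (le_antisymm hsum (sum_nonneg fun b _ => mul_nonneg (hneg0 b) (h.pos b v).le)) a (mem_univ a)
  have hna : neg a = 0 := (mul_eq_zero.1 hzero).resolve_right (h.pos a v).ne'
  have : -ν a ≤ 0 := hna ▸ le_max_left _ _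
  simp only [hν] at this
  linarith

theorem IsPositiveChain.le_of_single_row {Q Q' : Matrix ι ι ℝ} {π π' : ι → ℝ}
    (h : IsPositiveChain Q π) (h' : IsPositiveChain Q' π') {v : ι}
    (hne : ∀ a, a ≠ v → Q' a = Q a) {c : ℝ} (hc : 1 ≤ c)
    (hQ : ∀ b, Q' v b ≤ c * Q v b) (hQ' : ∀ b, Q v b ≤ c * Q' v b) (a : ι) :
    π' a ≤ c ^ 2 * π a := by
  have h1 := h.cross_le h' hne hc hQ a
  have h2 : π' v ≤ c * π v := by
    have := sum_le_sum fun a (_ : a ∈ univ) => h'.cross_le h (fun a ha => (hne a ha).symm) hc hQ' a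
    rwa [← mul_sum, ← mul_sum, h.mem.2, h'.mem.2, mul_one, mul_one] at this
  have hv := h.pi_pos v
  have ha := h.pi_pos a
  refine le_of_mul_le_mul_left (a := π v) ?_ hv
  calc π v * π' a ≤ c * π' v * π a := h1
    _ ≤ c * (c * π v) * π a := by gcongr
    _ = π v * (c ^ 2 * π a) := by ring

/-- Changes of several rows, made one at a time; the stationary distributions of the intermediate
chains are provided by `exists_isPositiveChain`. -/
theorem IsPositiveChain.le_of_rows [DecidableEq ι] {Q : Matrix ι ι ℝ} {π : ι → ℝ}
    (h : IsPositiveChain Q π) {δ : ι → ℝ} (hδ : ∀ a, 0 ≤ δ a) (s : Finset ι) :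
    ∀ {Q' : Matrix ι ι ℝ} {π' : ι → ℝ}, IsPositiveChain Q' π' → (∀ a, a ∉ s → Q' a = Q a) →
      (∀ a b, Q' a b ≤ Real.exp (δ a) * Q a b) → (∀ a b, Q a b ≤ Real.exp (δ a) * Q' a b) →
      ∀ a, π' a ≤ Real.exp (2 * ∑ v ∈ s, δ v) * π a := by
  induction s using Finset.induction_on with
  | empty =>
    intro Q' π' h' hs hQ hQ' a
    have := h.le_of_single_row h' (v := a) (fun b _ => hs b (notMem_empty b)) le_rfl
      (fun b => by rw [hs a (notMem_empty a), one_mul])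
      (fun b => by rw [hs a (notMem_empty a), one_mul]) a
    simpa using this
  | insert k s hk ih =>
    intro Q' π' h' hs hQ hQ' a
    have : Nonempty ι := ⟨k⟩
    have hpos : ∀ a b, 0 < Q'.updateRow k (Q k) a b := by
      intro a b
      by_cases ha : a = k
      · subst ha; simpa using h.pos a b
      · simpa [updateRow_ne ha] using h'.pos a b
    have hrow : ∀ a, ∑ b, Q'.updateRow k (Q k) a b = 1 := by
      intro a
      by_cases ha : a = k
      · subst ha; simpa using h.row_sum a
      · simpa [updateRow_ne ha] using h'.row_sum a
    obtain ⟨p, hp⟩ := exists_isPositiveChain (Q := Q'.updateRow k (Q k)) hpos hrow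
    have hone : ∀ a, 1 ≤ Real.exp (δ a) := fun a => Real.one_le_exp (hδ a)
    have h1 := ih hp
      (fun a ha => by
        by_cases hak : a = k
        · subst hak; ext b; simp
        · ext b
          rw [updateRow_ne hak, hs a (by simp [hak, ha])])
      (fun a b => by
        by_cases hak : a = k
        · subst hak
          simpa using le_mul_of_one_le_left (h.pos a b).le (hone a)
        · simpa [updateRow_ne hak] using hQ a b)
      (fun a b => by
        by_cases hak : a = k
        · subst hak
          simpa using le_mul_of_one_le_left (h.pos a b).le (hone a)
        · simpa [updateRow_ne hak] using hQ' a b) a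
    have h2 := hp.le_of_single_row h' (v := k) (fun a ha => by ext b; rw [updateRow_ne ha])
      (hone k) (fun b => by simpa using hQ k b) (fun b => by simpa using hQ' k b) a
    rw [sum_insert hk, mul_add, Real.exp_add, mul_assoc, two_mul, Real.exp_add, ← sq]
    exact h2.trans (mul_le_mul_of_nonneg_left h1 (by positivity))

/-- Perturbation bound for stationary distributions: if the entries of row `a` change by factors in
`[exp (-δ a), exp (δ a)]`, then the stationary distribution moves by at most `4 ∑ a, δ a` in `ℓ₁`.
The bound does not depend on how fast the chain mixes. -/
theorem IsPositiveChain.sum_abs_sub_le {Q Q' : Matrix ι ι ℝ} {π π' : ι → ℝ}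
    (h : IsPositiveChain Q π) (h' : IsPositiveChain Q' π') {δ : ι → ℝ} (hδ : ∀ a, 0 ≤ δ a)
    (hQ : ∀ a b, Q' a b ≤ Real.exp (δ a) * Q a b)
    (hQ' : ∀ a b, Q a b ≤ Real.exp (δ a) * Q' a b) :
    ∑ a, |π' a - π a| ≤ 4 * ∑ a, δ a := by
  classical
  set D := ∑ a, δ a with hD
  have hD0 : 0 ≤ D := sum_nonneg fun a _ => hδ a
  have key : ∀ a, |π' a - π a| ≤ 2 * (2 * D * π' a) + (π a - π' a) := by
    intro a
    have h1 := h.le_of_rows hδ univ h' (fun a ha => absurd (mem_univ a) ha) hQ hQ' a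
    rw [← hD] at h1
    have hp' := (h'.pi_pos a).le
    have h2 : π' a * (1 - 2 * D) ≤ π a := by
      calc π' a * (1 - 2 * D) ≤ π' a * Real.exp (-(2 * D)) := by
            gcongr
            have := Real.add_one_le_exp (-(2 * D))
            linarith
        _ ≤ (Real.exp (2 * D) * π a) * Real.exp (-(2 * D)) := by gcongr
        _ = π a := by
            rw [mul_right_comm, ← Real.exp_add]; simp
    rw [abs_le]
    constructor <;> nlinarith [mul_nonneg hD0 hp']
  have := sum_le_sum fun a (_ : a ∈ univ) => key a
  rw [sum_add_distrib, sum_sub_distrib, h.mem.2, h'.mem.2, ← mul_sum, ← mul_sum, h'.mem.2] at this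
  linarith

end Stationary

/-! ### The logarithmic barrier -/

/-- The Bregman divergence `D_φ(z, y)` of the logarithmic barrier `φ`, written in terms of the
ratios `z k / y k`. -/
def barrierDiv {d : ℕ} (z y : Fin d → ℝ) : ℝ := ∑ k, (z k / y k - 1 - Real.log (z k / y k))

/-- The objective of follow the regularized leader with logarithmic barrier, learning rate `η` and
cumulative utility `c`. -/
def ftrlObjective {d : ℕ} (η : ℝ) (c y : Fin d → ℝ) : ℝ := y ⬝ᵥ c - logBarrier y / η

theorem sub_one_sub_log_nonneg {r : ℝ} (hr : 0 < r) : 0 ≤ r - 1 - Real.log r := by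
  linarith [Real.log_le_sub_one_of_pos hr]

theorem barrierDiv_nonneg {d : ℕ} {z y : Fin d → ℝ} (hz : ∀ k, 0 < z k) (hy : ∀ k, 0 < y k) :
    0 ≤ barrierDiv z y :=
  sum_nonneg fun k _ => sub_one_sub_log_nonneg (div_pos (hz k) (hy k))

theorem min_one_log_sq_le {r : ℝ} (hr : 0 < r) :
    min 1 (Real.log r ^ 2) ≤ 4 * (r - 1 - Real.log r) := by
  obtain ⟨s, rfl⟩ : ∃ s, Real.exp s = r := ⟨Real.log r, Real.exp_log hr⟩
  rw [Real.log_exp]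
  by_cases h0 : 0 ≤ s
  · have := Real.quadratic_le_exp_of_nonneg h0
    exact (min_le_right _ _).trans (by nlinarith)
  -- Taylor expansion near `0`; further left the tangent of `exp` at `-1` suffices.
  by_cases h1 : -1 ≤ s
  · have habs : |s| ≤ 1 := abs_le.2 ⟨h1, by linarith⟩
    have := Real.exp_bound habs (n := 3) (by norm_num)
    simp only [sum_range_succ, range_zero, sum_empty, Nat.factorial] at this
    norm_num at this
    have h2 := (abs_le.1 this).1
    have h3 : |s| ^ 3 ≤ s ^ 2 := by
      rw [← sq_abs s]
      exact pow_le_pow_of_le_one (abs_nonneg s) habs (by norm_num)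
    exact (min_le_right _ _).trans (by nlinarith)
  · push Not at h1
    have h2 := Real.add_one_le_exp (s + 1)
    have h3 : Real.exp s = Real.exp (-1) * Real.exp (s + 1) := by
      rw [← Real.exp_add]; ring_nf
    have h4 := Real.exp_neg_one_gt_d9
    have h5 := Real.exp_neg_one_lt_d9
    have h6 : Real.exp (-1) * (s + 2) ≤ Real.exp s := by
      rw [h3]
      exact mul_le_mul_of_nonneg_left (by linarith) (Real.exp_pos _).le
    exact (min_le_left _ _).trans (by nlinarith)

theorem min_one_log_sq_le_barrierDiv {d : ℕ} {z y : Fin d → ℝ} (hz : ∀ k, 0 < z k)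
    (hy : ∀ k, 0 < y k) (k : Fin d) :
    min 1 (Real.log (z k / y k) ^ 2) ≤ 4 * barrierDiv z y := by
  refine (min_one_log_sq_le (div_pos (hz k) (hy k))).trans ?_
  refine mul_le_mul_of_nonneg_left ?_ (by norm_num)
  exact single_le_sum (f := fun k => z k / y k - 1 - Real.log (z k / y k))
    (fun j _ => sub_one_sub_log_nonneg (div_pos (hz j) (hy j))) (mem_univ k)

/-- Fenchel's inequality for `r ↦ r - 1 - log r`, whose conjugate is `z ↦ -z - log (1 - z)`. -/
theorem mul_sub_one_le {r z : ℝ} (hr : 0 < r) (hz : |z| ≤ 1 / 2) :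
    z * (r - 1) - (r - 1 - Real.log r) ≤ 2 * z ^ 2 := by
  obtain ⟨h1, h2⟩ := abs_le.1 hz
  have hz1 : 0 < 1 - z := by linarith
  have e1 : Real.log r ≤ r * (1 - z) - 1 - Real.log (1 - z) := by
    have := Real.log_le_sub_one_of_pos (mul_pos hr hz1)
    rw [Real.log_mul hr.ne' hz1.ne'] at this
    linarith
  have e2 : -Real.log (1 - z) ≤ z + 2 * z ^ 2 := by
    have h3 := Real.log_le_sub_one_of_pos (inv_pos.2 hz1)
    rw [Real.log_inv] at h3
    have h4 : (1 - z)⁻¹ ≤ 1 + z + 2 * z ^ 2 := by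
      rw [inv_le_iff_one_le_mul₀ hz1]
      nlinarith [sq_nonneg z, mul_nonneg (sq_nonneg z) (by linarith : 0 ≤ 1 - 2 * z)]
    linarith
  nlinarith

/-- The stability estimate of optimistic FTRL: the gain of moving from `y` to `g` against `v` is
paid for by half of the divergence up to a term quadratic in `v`. -/
theorem stability_le {d : ℕ} {g y v : Fin d → ℝ} (hg : ∀ k, 0 < g k) (hy : y ∈ posSimplex d)
    {η : ℝ} (hη : 0 < η) (hv : η * ‖v‖ ≤ 1 / 4) :
    (g - y) ⬝ᵥ v - barrierDiv g y / (2 * η) ≤ 4 * η * ‖v‖ ^ 2 := by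
  have hle1 : ∀ k, y k ≤ 1 := fun k => by
    rw [← hy.1.2]
    exact single_le_sum (fun j _ => hy.1.1 j) (mem_univ k)
  have key : ∀ k, (g k - y k) * v k - (g k / y k - 1 - Real.log (g k / y k)) / (2 * η)
      ≤ 4 * η * ‖v‖ ^ 2 * y k := by
    intro k
    have hyk := hy.2 k
    have hvk : |v k| ≤ ‖v‖ := by simpa using norm_le_pi_norm v k
    have hz : |2 * η * y k * v k| ≤ 1 / 2 := by
      rw [abs_mul, abs_of_pos (by positivity : 0 < 2 * η * y k)]
      calc 2 * η * y k * |v k| ≤ 2 * η * 1 * ‖v‖ := by gcongr; exact hle1 k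
        _ ≤ 1 / 2 := by linarith
    have h1 := mul_sub_one_le (div_pos (hg k) hyk) hz
    have h2 : (g k - y k) * v k - (g k / y k - 1 - Real.log (g k / y k)) / (2 * η)
        = (2 * η * y k * v k * (g k / y k - 1) - (g k / y k - 1 - Real.log (g k / y k)))
          / (2 * η) := by
      field_simp
    rw [h2, div_le_iff₀ (by positivity)]
    refine h1.trans ?_
    have h3 : v k ^ 2 ≤ ‖v‖ ^ 2 := by
      rw [← sq_abs]; gcongr
    calc 2 * (2 * η * y k * v k) ^ 2 = 8 * η ^ 2 * (y k * y k) * v k ^ 2 := by ring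
      _ ≤ 8 * η ^ 2 * (y k * 1) * ‖v‖ ^ 2 := by gcongr; exact hle1 k
      _ = _ := by ring
  have := sum_le_sum fun k (_ : k ∈ univ) => key k
  rw [sum_sub_distrib, ← sum_div, ← mul_sum, hy.1.2, mul_one] at this
  exact this

/-- The barrier is minimal at the uniform distribution. -/
theorem logBarrier_ge {d : ℕ} {y : Fin d → ℝ} (hy : y ∈ posSimplex d) :
    d * Real.log d ≤ logBarrier y := by
  -- `log (d y) ≤ d y - 1`, with equality at the uniform distribution
  have key : ∀ k, Real.log d + Real.log (y k) ≤ d * y k - 1 := by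
    intro k
    have hd : (0 : ℝ) < d := by exact_mod_cast k.pos
    rw [← Real.log_mul hd.ne' (hy.2 k).ne']
    exact Real.log_le_sub_one_of_pos (mul_pos hd (hy.2 k))
  have := sum_le_sum fun k (_ : k ∈ univ) => key k
  rw [sum_add_distrib, sum_sub_distrib, ← mul_sum, hy.1.2] at this
  simp only [sum_const, card_univ, Fintype.card_fin, nsmul_eq_mul, mul_one] at this
  unfold logBarrier
  linarith

/-- First-order optimality of a maximizer `y`, with the gap measured by the Bregman divergence. -/
theorem ftrlObjective_le {d : ℕ} {η : ℝ} (hη : 0 < η) {c y z : Fin d → ℝ} (hy : y ∈ posSimplex d)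
    (hmax : IsMaxOn (ftrlObjective η c) (posSimplex d) y) (hz : z ∈ posSimplex d) :
    ftrlObjective η c z ≤ ftrlObjective η c y - barrierDiv z y / η := by
  set r : Fin d → ℝ := fun k => z k / y k with hr
  have hrpos : ∀ k, 0 < r k := fun k => div_pos (hz.2 k) (hy.2 k)
  have hzr : ∀ k, z k = y k * r k := fun k => by
    simp only [hr]; rw [mul_div_cancel₀ _ (hy.2 k).ne']
  have hbar : ∀ r : Fin d → ℝ, (∀ k, 0 < r k) →
      logBarrier (fun k => y k * r k) = logBarrier y - ∑ k, Real.log (r k) := by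
    intro r hr
    simp only [logBarrier, fun k => Real.log_mul (hy.2 k).ne' (hr k).ne', sum_add_distrib]
    ring
  have hpos : ∀ s ∈ Set.Ioc (0 : ℝ) 1, ∀ k, 0 < 1 + s * (r k - 1) := by
    intro s hs k
    nlinarith [hs.1, hs.2, mul_pos hs.1 (hrpos k)]
  -- The directional derivative of the objective at `y` towards `z` is nonpositive.
  have hfirst : ∀ s ∈ Set.Ioc (0 : ℝ) 1,
      (z - y) ⬝ᵥ c + (∑ k, (r k - 1) / (1 + s * (r k - 1))) / η ≤ 0 := by
    intro s hs
    have hmem : (fun k => y k * (1 + s * (r k - 1))) ∈ posSimplex d := by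
      refine ⟨⟨fun k => (mul_pos (hy.2 k) (hpos s hs k)).le, ?_⟩,
        fun k => mul_pos (hy.2 k) (hpos s hs k)⟩
      have : ∀ k, y k * (1 + s * (r k - 1)) = (1 - s) * y k + s * z k := fun k => by
        rw [hzr]; ring
      simp only [this, sum_add_distrib, ← mul_sum, hy.1.2, hz.1.2]
      ring
    have h1 := hmax hmem
    simp only [Set.mem_ofPred_eq, ftrlObjective] at h1
    rw [hbar _ (hpos s hs)] at h1
    have h2 : (fun k => y k * (1 + s * (r k - 1))) ⬝ᵥ c = y ⬝ᵥ c + s * ((z - y) ⬝ᵥ c) := by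
      simp only [dotProduct, mul_sum, ← sum_add_distrib]
      refine sum_congr rfl fun k _ => ?_
      rw [Pi.sub_apply, hzr]; ring
    rw [h2, sub_div] at h1
    have h3 : s * ∑ k, (r k - 1) / (1 + s * (r k - 1)) ≤ ∑ k, Real.log (1 + s * (r k - 1)) := by
      rw [mul_sum]
      refine sum_le_sum fun k _ => ?_
      have h4 := Real.one_sub_inv_le_log_of_pos (hpos s hs k)
      have h5 : s * ((r k - 1) / (1 + s * (r k - 1))) = 1 - (1 + s * (r k - 1))⁻¹ := by
        have := (hpos s hs k).ne'
        field_simp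
        ring
      rw [h5]; exact h4
    have h4 : s * ((z - y) ⬝ᵥ c) + (s * ∑ k, (r k - 1) / (1 + s * (r k - 1))) / η ≤ 0 := by
      have := div_le_div_of_nonneg_right h3 hη.le
      linarith
    rw [mul_div_assoc, ← mul_add] at h4
    exact nonpos_of_mul_nonpos_right h4 hs.1
  have hlim : (z - y) ⬝ᵥ c + (∑ k, (r k - 1)) / η ≤ 0 := by
    have hcont : Filter.Tendsto
        (fun s : ℝ => (z - y) ⬝ᵥ c + (∑ k, (r k - 1) / (1 + s * (r k - 1))) / η)
        (nhdsWithin 0 (Set.Ioi 0)) (nhds ((z - y) ⬝ᵥ c + (∑ k, (r k - 1)) / η)) := by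
      have : ContinuousAt
          (fun s : ℝ => (z - y) ⬝ᵥ c + (∑ k, (r k - 1) / (1 + s * (r k - 1))) / η) 0 := by
        refine continuousAt_const.add (ContinuousAt.div_const ?_ _)
        refine tendsto_finsetSum _ fun k _ => ?_
        refine ContinuousAt.div continuousAt_const (by fun_prop) (by simp)
      have h := this.tendsto.mono_left (nhdsWithin_le_nhds (s := Set.Ioi 0))
      simpa using h
    refine le_of_tendsto hcont ?_
    filter_upwards [Ioc_mem_nhdsGT (zero_lt_one' ℝ)] with s hs using hfirst s hs
  have hz' : logBarrier z = logBarrier y - ∑ k, Real.log (r k) := by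
    rw [← hbar r hrpos]
    exact congrArg _ (funext hzr)
  have hD : barrierDiv z y = ∑ k, (r k - 1) - ∑ k, Real.log (r k) := by
    rw [← sum_sub_distrib]; rfl
  rw [ftrlObjective, ftrlObjective, hz', hD]
  rw [sub_dotProduct] at hlim
  rw [sub_div, sub_div]
  linarith

theorem const_mem_posSimplex {d : ℕ} (hd : 1 ≤ d) :
    (fun _ => 1 / (d : ℝ)) ∈ posSimplex d := by
  have : (0 : ℝ) < d := by exact_mod_cast hd
  refine ⟨⟨fun _ => by positivity, ?_⟩, fun _ => by positivity⟩
  simp [this.ne']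

theorem exists_isMaxOn_ftrlObjective {d : ℕ} (hd : 1 ≤ d) {η : ℝ} (hη : 0 < η) (c : Fin d → ℝ) :
    ∃ g ∈ posSimplex d, IsMaxOn (ftrlObjective η c) (posSimplex d) g := by
  set u₀ : Fin d → ℝ := fun _ => 1 / (d : ℝ) with hu₀
  have hu₀mem : u₀ ∈ posSimplex d := const_mem_posSimplex hd
  set B : ℝ := η * (ftrlObjective η c u₀ - ∑ k, |c k|) with hB
  -- Points at least as good as the uniform distribution stay away from the boundary.
  have hbound : ∀ y ∈ posSimplex d, ftrlObjective η c u₀ ≤ ftrlObjective η c y →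
      ∀ k, Real.exp B ≤ y k := by
    intro y hy hle k
    have hle1 : ∀ j, y j ≤ 1 := fun j => by
      rw [← hy.1.2]
      exact single_le_sum (fun j _ => hy.1.1 j) (mem_univ j)
    have h1 : y ⬝ᵥ c ≤ ∑ k, |c k| := sum_le_sum fun j _ => by
      nlinarith [le_abs_self (c j), abs_nonneg (c j), hle1 j, hy.1.1 j,
        mul_le_mul_of_nonneg_left (le_abs_self (c j)) (hy.1.1 j)]
    have h2 : -Real.log (y k) ≤ logBarrier y := by
      rw [logBarrier, ← sum_neg_distrib]
      exact single_le_sum (f := fun j => -Real.log (y j))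
        (fun j _ => neg_nonneg.2 (Real.log_nonpos (hy.1.1 j) (hle1 j))) (mem_univ k)
    rw [← Real.le_log_iff_exp_le (hy.2 k), hB]
    have h3 : ftrlObjective η c u₀ ≤ ∑ k, |c k| + Real.log (y k) / η := by
      refine hle.trans ?_
      rw [ftrlObjective]
      have := div_le_div_of_nonneg_right h2 hη.le
      rw [neg_div] at this
      linarith
    rw [← le_div_iff₀' hη]
    linarith
  set S : Set (Fin d → ℝ) := stdSimplex ℝ (Fin d) ∩ {y | ∀ k, Real.exp B ≤ y k} with hS
  have hSc : IsCompact S := by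
    refine (isCompact_stdSimplex ℝ (Fin d)).inter_right ?_
    simp only [Set.ofPred_forall]
    exact isClosed_iInter fun k => isClosed_le continuous_const (continuous_apply k)
  have hcont : ContinuousOn (ftrlObjective η c) S := by
    unfold ftrlObjective logBarrier
    refine ContinuousOn.sub (by unfold dotProduct; fun_prop) (ContinuousOn.div_const ?_ _)
    refine ContinuousOn.neg (continuousOn_finsetSum _ fun k _ => ?_)
    exact (continuous_apply k).continuousOn.log
      fun y hy => ((Real.exp_pos B).trans_le (hy.2 k)).ne'
  have hu₀S : u₀ ∈ S := ⟨hu₀mem.1, hbound u₀ hu₀mem le_rfl⟩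
  obtain ⟨g, hgS, hg⟩ := hSc.exists_isMaxOn ⟨u₀, hu₀S⟩ hcont
  refine ⟨g, ⟨hgS.1, fun k => (Real.exp_pos B).trans_le (hgS.2 k)⟩, fun y hy => ?_⟩
  by_cases h : ftrlObjective η c u₀ ≤ ftrlObjective η c y
  · exact hg ⟨hy.1, hbound y hy h⟩
  · exact (not_le.1 h).le.trans (hg hu₀S)

/-! ### Regret of optimistic FTRL with adaptive learning rates -/

/-- One round of optimistic FTRL: the potential
`⟨g, W⟩ - (φ(g) - Z) / η`, evaluated at the (non-optimistic) leaders `g` and `g'` before and after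
the round, grows by at most the payoff `⟨y, w⟩` plus the stability term, minus half of the
divergences along the path `g → y → g'`. -/
theorem oftrl_step {d : ℕ} {η η' Z : ℝ} (hη' : 0 < η') (hηη' : η' ≤ η)
    (hZ : ∀ y ∈ posSimplex d, Z ≤ logBarrier y) {W w₀ w g g' y : Fin d → ℝ}
    (hg : g ∈ posSimplex d) (hgmax : IsMaxOn (ftrlObjective η W) (posSimplex d) g)
    (hg' : g' ∈ posSimplex d)
    (hy : y ∈ posSimplex d) (hymax : IsMaxOn (ftrlObjective η (w₀ + W)) (posSimplex d) y)
    (hv : η * ‖w - w₀‖ ≤ 1 / 4) :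
    g' ⬝ᵥ (W + w) - (logBarrier g' - Z) / η' ≤ g ⬝ᵥ W - (logBarrier g - Z) / η
      + y ⬝ᵥ w + 4 * (η * ‖w - w₀‖ ^ 2)
      - 1 / (2 * η) * (barrierDiv g' y + barrierDiv y g) := by
  have hη : 0 < η := hη'.trans_le hηη'
  have h1 := ftrlObjective_le hη hy hymax hg'
  have h2 := ftrlObjective_le hη hg hgmax hy
  have h3 := stability_le hg'.2 hy hη hv
  have h4 : (logBarrier g' - Z) / η ≤ (logBarrier g' - Z) / η' :=
    div_le_div_of_nonneg_left (sub_nonneg.2 (hZ g' hg')) hη' hηη'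
  have h5 : 0 ≤ barrierDiv y g / (2 * η) :=
    div_nonneg (barrierDiv_nonneg hy.2 hg.2) (by positivity)
  simp only [ftrlObjective, dotProduct_add] at h1 h2
  rw [sub_dotProduct, dotProduct_sub, dotProduct_sub] at h3
  rw [dotProduct_add]
  have h6 : ∀ x : ℝ, x / η = x / (2 * η) + x / (2 * η) := fun x => by field_simp; ring
  have h7 : 1 / (2 * η) * (barrierDiv g' y + barrierDiv y g)
      = barrierDiv g' y / (2 * η) + barrierDiv y g / (2 * η) := by ring
  rw [h7]
  rw [h6 (barrierDiv g' y)] at h1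
  rw [h6 (barrierDiv y g)] at h2
  rw [sub_div] at h4 ⊢
  rw [sub_div] at h4 ⊢
  linarith

/-- Regret of optimistic FTRL with logarithmic barrier and nonincreasing learning rates. The
sequence `g` consists of the leaders without the optimistic prediction. -/
theorem oftrl_regret_le {d : ℕ} (hd : 1 ≤ d) (T : ℕ) {η : ℕ → ℝ} (hη : ∀ t, 0 < η t)
    (hanti : ∀ t, 1 ≤ t → η (t + 1) ≤ η t) {w y : ℕ → Fin d → ℝ}
    (hy : ∀ t ∈ Icc 1 T, y t ∈ posSimplex d ∧
      IsMaxOn (ftrlObjective (η t) (w (t - 1) + ∑ s ∈ Ico 1 t, w s)) (posSimplex d) (y t))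
    (hw : ∀ t ∈ Icc 1 T, η t * ‖w t - w (t - 1)‖ ≤ 1 / 4) :
    ∃ g : ℕ → Fin d → ℝ, (∀ t, g t ∈ posSimplex d) ∧ ∀ z ∈ posSimplex d,
      ∑ t ∈ Icc 1 T, (z - y t) ⬝ᵥ w t ≤ (logBarrier z - d * Real.log d) / η (T + 1)
        + 4 * ∑ t ∈ Icc 1 T, η t * ‖w t - w (t - 1)‖ ^ 2
        - ∑ t ∈ Icc 1 T, 1 / (2 * η t) * (barrierDiv (g (t + 1)) (y t) + barrierDiv (y t) (g t)) := by
  choose g hg hgmax using fun t =>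
    exists_isMaxOn_ftrlObjective hd (hη t) (∑ s ∈ Ico 1 t, w s)
  refine ⟨g, hg, fun z hz => ?_⟩
  have key : ∀ N ≤ T, g (N + 1) ⬝ᵥ (∑ s ∈ Ico 1 (N + 1), w s)
      - (logBarrier (g (N + 1)) - d * Real.log d) / η (N + 1) ≤
      ∑ t ∈ Icc 1 N, y t ⬝ᵥ w t + 4 * ∑ t ∈ Icc 1 N, η t * ‖w t - w (t - 1)‖ ^ 2
        - ∑ t ∈ Icc 1 N, 1 / (2 * η t) *
          (barrierDiv (g (t + 1)) (y t) + barrierDiv (y t) (g t)) := by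
    intro N
    induction N with
    | zero =>
      intro _
      have := div_nonneg (sub_nonneg.2 (logBarrier_ge (hg 1))) (hη 1).le
      simpa using this
    | succ N ih =>
      intro hN
      have hmem : N + 1 ∈ Icc 1 T := mem_Icc.2 ⟨by omega, hN⟩
      have h1 := oftrl_step (hη (N + 1 + 1)) (hanti (N + 1) (by omega))
        (fun y hy => logBarrier_ge hy) (hg (N + 1)) (hgmax (N + 1)) (hg (N + 1 + 1))
        (hy _ hmem).1 (hy _ hmem).2 (hw _ hmem)
      have h2 := ih (by omega)
      rw [sum_Ico_succ_top (by omega : 1 ≤ N + 1)]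
      rw [sum_Icc_succ_top (by omega : 1 ≤ N + 1), sum_Icc_succ_top (by omega : 1 ≤ N + 1),
        sum_Icc_succ_top (by omega : 1 ≤ N + 1)]
      linarith
  have h1 := key T le_rfl
  have h2 := hgmax (T + 1) hz
  simp only [Set.mem_ofPred_eq, ftrlObjective] at h2
  have h3 : ∑ t ∈ Icc 1 T, (z - y t) ⬝ᵥ w t
      = z ⬝ᵥ (∑ s ∈ Ico 1 (T + 1), w s) - ∑ t ∈ Icc 1 T, y t ⬝ᵥ w t := by
    rw [dotProduct_sum]
    simp only [sub_dotProduct, sum_sub_distrib]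
    rfl
  rw [h3]
  rw [sub_div] at h1 ⊢
  linarith

/-- Mixing a little of the uniform distribution into `z` makes the barrier finite at a cost of
`2` in regret. -/
theorem exists_posSimplex_near {d : ℕ} (hd : 1 ≤ d) {T : ℕ} (hT : 1 ≤ T) {w : ℕ → Fin d → ℝ}
    (hw : ∀ t ∈ Icc 1 T, ‖w t‖ ≤ 1) {z : Fin d → ℝ} (hz : z ∈ stdSimplex ℝ (Fin d)) :
    ∃ z' ∈ posSimplex d, logBarrier z' - d * Real.log d ≤ d * Real.log T ∧
      ∑ t ∈ Icc 1 T, (z - z') ⬝ᵥ w t ≤ 2 := by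
  have hd0 : (0 : ℝ) < d := by exact_mod_cast hd
  have hT0 : (0 : ℝ) < T := by exact_mod_cast hT
  have hT1 : (1 : ℝ) / T ≤ 1 := by
    rw [div_le_one hT0]; exact_mod_cast hT
  set z' : Fin d → ℝ := fun k => (1 - 1 / T) * z k + 1 / (d * T) with hz'
  have hlow : ∀ k, 1 / ((d : ℝ) * T) ≤ z' k := fun k => by
    have := mul_nonneg (sub_nonneg.2 hT1) (hz.1 k)
    simp only [hz']; linarith
  have hpos : ∀ k, 0 < z' k := fun k => lt_of_lt_of_le (by positivity) (hlow k)
  refine ⟨z', ⟨⟨fun k => (hpos k).le, ?_⟩, hpos⟩, ?_, ?_⟩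
  · simp only [hz', sum_add_distrib, ← mul_sum, hz.2]
    simp only [sum_const, card_univ, Fintype.card_fin, nsmul_eq_mul]
    field_simp
    ring
  · have : ∀ k, -Real.log (z' k) ≤ Real.log d + Real.log T := fun k => by
      have := Real.log_le_log (by positivity) (hlow k)
      rw [one_div, Real.log_inv, Real.log_mul hd0.ne' hT0.ne'] at this
      linarith
    have h := sum_le_sum fun k (_ : k ∈ univ) => this k
    rw [sum_neg_distrib] at h
    simp only [sum_const, card_univ, Fintype.card_fin, nsmul_eq_mul] at h
    simp only [logBarrier]
    linarith
  · have : ∀ t ∈ Icc 1 T, (z - z') ⬝ᵥ w t ≤ 2 / T := by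
      intro t ht
      have hk : ∀ k, (z - z') k * w t k ≤ 1 / T * z k + 1 / (d * T) := fun k => by
        have h1 : |w t k| ≤ 1 := by
          have := norm_le_pi_norm (w t) k
          rw [Real.norm_eq_abs] at this
          exact this.trans (hw t ht)
        have h2 := abs_le.1 h1
        have h3 : 0 ≤ 1 / T * z k := mul_nonneg (by positivity) (hz.1 k)
        have h4 : 0 ≤ 1 / ((d : ℝ) * T) := by positivity
        have h5 : (z - z') k = 1 / T * z k - 1 / (d * T) := by
          simp only [Pi.sub_apply, hz']; ring
        rw [h5]
        nlinarith
      refine (sum_le_sum fun k _ => hk k).trans (le_of_eq ?_)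
      rw [sum_add_distrib, ← mul_sum, hz.2]
      simp only [sum_const, card_univ, Fintype.card_fin, nsmul_eq_mul]
      field_simp
      norm_num
    refine (sum_le_sum this).trans (le_of_eq ?_)
    simp only [sum_const, Nat.card_Icc, nsmul_eq_mul, Nat.add_sub_cancel]
    field_simp

theorem learningRate_pos {n T d : ℕ} (hn : 1 ≤ n) (hT : 2 ≤ T) (hd : 1 ≤ d) (w : ℕ → Fin d → ℝ)
    (t : ℕ) : 0 < learningRate n T w t := by
  have hd0 : (0 : ℝ) < d := by exact_mod_cast hd
  have hn0 : (0 : ℝ) < n := by exact_mod_cast hn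
  have hL : 0 < Real.log T := Real.log_pos (by exact_mod_cast hT)
  have : 0 ≤ ∑ s ∈ Ico 1 t, ‖w s - w (s - 1)‖ ^ 2 := sum_nonneg fun _ _ => by positivity
  exact lt_min (by positivity) (by positivity)

theorem learningRate_succ_le (n T : ℕ) {d : ℕ} (w : ℕ → Fin d → ℝ) (t : ℕ) :
    learningRate n T w (t + 1) ≤ learningRate n T w t := by
  have hP : 0 ≤ ∑ s ∈ Ico 1 t, ‖w s - w (s - 1)‖ ^ 2 := sum_nonneg fun _ _ => by positivity
  have hle : ∑ s ∈ Ico 1 t, ‖w s - w (s - 1)‖ ^ 2 ≤ ∑ s ∈ Ico 1 (t + 1), ‖w s - w (s - 1)‖ ^ 2 :=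
    sum_le_sum_of_subset_of_nonneg (Ico_subset_Ico_right (Nat.le_succ t))
      fun _ _ _ => by positivity
  have hL : 0 ≤ Real.log T := Real.log_natCast_nonneg T
  refine min_le_min_right _ (Real.sqrt_le_sqrt ?_)
  exact div_le_div_of_nonneg_left (by positivity) (by linarith) (by linarith)

/-- The adaptive learning rate turns the stability terms into `√(∑ ‖w^t - w^{t-1}‖²)`. -/
theorem sum_learningRate_le {n T d : ℕ} (w : ℕ → Fin d → ℝ) {N : ℕ}
    (hw : ∀ t ∈ Icc 1 N, ‖w t - w (t - 1)‖ ≤ 2) :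
    ∑ t ∈ Icc 1 N, learningRate n T w t * ‖w t - w (t - 1)‖ ^ 2 ≤
      2 * √(d * Real.log T / 8) * √(∑ t ∈ Icc 1 N, ‖w t - w (t - 1)‖ ^ 2) := by
  induction N with
  | zero => simp
  | succ N ih =>
    have h1 := ih fun t ht => hw t (Icc_subset_Icc_right (Nat.le_succ N) ht)
    rw [sum_Icc_succ_top (by omega), sum_Icc_succ_top (by omega)]
    set P := ∑ t ∈ Icc 1 N, ‖w t - w (t - 1)‖ ^ 2 with hP
    have hP0 : 0 ≤ P := sum_nonneg fun _ _ => by positivity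
    have h2 := hw (N + 1) (by simp)
    set a := ‖w (N + 1) - w (N + 1 - 1)‖ ^ 2 with ha
    have ha0 : 0 ≤ a := by positivity
    have ha4 : a ≤ 4 := by
      rw [ha]
      nlinarith [norm_nonneg (w (N + 1) - w (N + 1 - 1))]
    have h3 : learningRate n T w (N + 1) ≤ √(d * Real.log T / 8) / √(4 + P) := by
      refine (min_le_left _ _).trans (le_of_eq ?_)
      rw [Real.sqrt_div' _ (add_nonneg (by norm_num) (sum_nonneg fun _ _ => by positivity))]
      rfl
    have hb : 0 < √(4 + P) := Real.sqrt_pos.2 (by linarith)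
    have h4 : a / √(4 + P) ≤ 2 * (√(P + a) - √P) := by
      rw [div_le_iff₀ hb]
      have e1 := Real.sq_sqrt hP0
      have e2 := Real.sq_sqrt (add_nonneg hP0 ha0)
      have e3 : √P ≤ √(P + a) := Real.sqrt_le_sqrt (by linarith)
      have e4 : √(P + a) ≤ √(4 + P) := Real.sqrt_le_sqrt (by linarith)
      nlinarith [mul_le_mul_of_nonneg_left e4 (sub_nonneg.2 e3),
        mul_le_mul_of_nonneg_left (e3.trans e4) (sub_nonneg.2 e3)]
    have h5 : learningRate n T w (N + 1) * a ≤ √(d * Real.log T / 8) * (2 * (√(P + a) - √P)) :=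
      calc _ ≤ √(d * Real.log T / 8) / √(4 + P) * a := by gcongr
        _ = √(d * Real.log T / 8) * (a / √(4 + P)) := by ring
        _ ≤ _ := by gcongr
    linarith

/-- Regret bound of a single expert. The negative term keeps track of the distance, in the geometry
of the barrier, travelled by the outputs `y t` through the intermediate points `g t`. -/
theorem expert_regret_le {n T d : ℕ} (hn : 1 ≤ n) (hT : 2 ≤ T) (hd : 1 ≤ d)
    {w y : ℕ → Fin d → ℝ} (hy : ∀ t ∈ Icc 1 T, IsOFTRLOutput n T w t (y t))
    (hw1 : ∀ t ∈ Icc 1 T, ‖w t‖ ≤ 1) (hw2 : ∀ t ∈ Icc 1 T, ‖w t - w (t - 1)‖ ≤ 2) :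
    ∃ g : ℕ → Fin d → ℝ, (∀ t, g t ∈ posSimplex d) ∧ ∀ z ∈ stdSimplex ℝ (Fin d),
      ∑ t ∈ Icc 1 T, (z - y t) ⬝ᵥ w t ≤ 2 + 256 * n * √d * (d * Real.log T)
        + 6 * √(d * Real.log T * (4 + ∑ t ∈ Icc 1 T, ‖w t - w (t - 1)‖ ^ 2))
        - 128 * n * √d *
          ∑ t ∈ Icc 1 T, (barrierDiv (g (t + 1)) (y t) + barrierDiv (y t) (g t)) := by
  have hd0 : (0 : ℝ) < d := by exact_mod_cast hd
  have hd1 : (1 : ℝ) ≤ √d := Real.one_le_sqrt.2 (by exact_mod_cast hd)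
  have hn0 : (1 : ℝ) ≤ n := by exact_mod_cast hn
  have hL : 0 < Real.log T := Real.log_pos (by exact_mod_cast hT)
  have hpos := learningRate_pos hn hT hd w
  have hup : ∀ t, learningRate n T w t ≤ 1 / (256 * n * √d) := fun t => min_le_right _ _
  have hnd : 1 ≤ n * √d := by nlinarith
  obtain ⟨g, hg, hreg⟩ := oftrl_regret_le hd T hpos (fun t _ => learningRate_succ_le n T w t) hy
    (fun t ht => by
      have h1 : learningRate n T w t ≤ 1 / 8 :=
        (hup t).trans (one_div_le_one_div_of_le (by norm_num) (by nlinarith))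
      nlinarith [hw2 t ht, norm_nonneg (w t - w (t - 1)), hpos t])
  refine ⟨g, hg, fun z hz => ?_⟩
  obtain ⟨z', hz', hbar, hnear⟩ := exists_posSimplex_near hd (by omega : 1 ≤ T) hw1 hz
  have h1 := hreg z' hz'
  have h2 := sum_learningRate_le (n := n) (T := T) w hw2
  set P := ∑ t ∈ Icc 1 T, ‖w t - w (t - 1)‖ ^ 2 with hP
  have hP0 : 0 ≤ P := sum_nonneg fun _ _ => by positivity
  set D : ℕ → ℝ := fun t => barrierDiv (g (t + 1)) (y t) + barrierDiv (y t) (g t) with hDdef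
  have hD0 : ∀ t ∈ Icc 1 T, 0 ≤ D t := fun t ht =>
    add_nonneg (barrierDiv_nonneg (hg _).2 (hy t ht).1.2) (barrierDiv_nonneg (hy t ht).1.2 (hg _).2)
  have h3 : 128 * n * √d * ∑ t ∈ Icc 1 T, D t
      ≤ ∑ t ∈ Icc 1 T, 1 / (2 * learningRate n T w t) * D t := by
    rw [mul_sum]
    refine sum_le_sum fun t ht => mul_le_mul_of_nonneg_right ?_ (hD0 t ht)
    rw [le_div_iff₀ (mul_pos two_pos (hpos t))]
    have := hup t
    rw [le_div_iff₀ (by positivity)] at this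
    linarith
  set q := √(d * Real.log T * (4 + P)) with hq
  have hq0 : 0 < q := Real.sqrt_pos.2 (by positivity)
  have hq2 : q ^ 2 = d * Real.log T * (4 + P) := Real.sq_sqrt (by positivity)
  -- `√(d log T / 8) √P ≤ q / √8`, and `8 / √8 ≤ 3`
  have h4 : √(d * Real.log T / 8) * √P ≤ 3 / 8 * q := by
    rw [← Real.sqrt_mul (by positivity)]
    refine Real.sqrt_le_iff.2 ⟨by positivity, ?_⟩
    rw [mul_pow, hq2]
    nlinarith [mul_pos hd0 hL]
  have h5 : d * Real.log T / learningRate n T w (T + 1)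
      ≤ 256 * n * √d * (d * Real.log T) + 3 * q := by
    rw [div_le_iff₀ (hpos _), learningRate]
    rcases min_choice (√((d * Real.log T / 8) / (4 + ∑ s ∈ Ico 1 (T + 1), ‖w s - w (s - 1)‖ ^ 2)))
      (1 / (256 * n * √d)) with h | h
    · rw [h]
      have e1 : ∑ s ∈ Ico 1 (T + 1), ‖w s - w (s - 1)‖ ^ 2 = P := rfl
      rw [e1]
      have e2 : √((d * Real.log T / 8) / (4 + P)) * (3 * q) ≥ d * Real.log T := by
        rw [ge_iff_le, ← sq_le_sq₀ (by positivity) (by positivity),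
          mul_pow (√_) (3 * q), mul_pow 3 q, hq2, Real.sq_sqrt (by positivity)]
        field_simp
        norm_num
      have e3 : 0 ≤ 256 * n * √d * (d * Real.log T)
        * √((d * Real.log T / 8) / (4 + P)) := by positivity
      linarith
    · rw [h, add_mul]
      have e1 : 256 * n * √d * (d * Real.log T) * (1 / (256 * n * √d)) = d * Real.log T := by
        field_simp
      rw [e1]
      have : 0 ≤ 3 * q * (1 / (256 * n * √d)) := by positivity
      linarith
  have h6 := div_le_div_of_nonneg_right hbar (hpos (T + 1)).le
  have h7 : ∑ t ∈ Icc 1 T, (z - y t) ⬝ᵥ w t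
      = ∑ t ∈ Icc 1 T, (z - z') ⬝ᵥ w t + ∑ t ∈ Icc 1 T, (z' - y t) ⬝ᵥ w t := by
    rw [← sum_add_distrib]
    refine sum_congr rfl fun t _ => ?_
    rw [← add_dotProduct, sub_add_sub_cancel]
  rw [h7]
  linarith

/-! ### Swap regret of one player -/

/-- The squared `ℓ₁` path length of the strategies `x^1, …, x^T`. -/
def pathLength {d : ℕ} (T : ℕ) (x : ℕ → Fin d → ℝ) : ℝ :=
  ∑ t ∈ Icc 2 T, l1norm (x t - x (t - 1)) ^ 2

/-- The squared `ℓ_∞` variation of the utilities `v^1, …, v^T`. -/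
def variation {d : ℕ} (T : ℕ) (v : ℕ → Fin d → ℝ) : ℝ :=
  ∑ t ∈ Icc 2 T, ‖v t - v (t - 1)‖ ^ 2

/-- The total squared variation of the utilities handed to the experts; the learning rates
of the experts adapt to it. -/
def expertVariation {d : ℕ} (T : ℕ) (xhat util : ℕ → Fin d → ℝ) : ℝ :=
  ∑ a, ∑ t ∈ Icc 1 T,
    ‖expertUtility xhat util a t - expertUtility xhat util a (t - 1)‖ ^ 2

theorem pathLength_nonneg {d : ℕ} (T : ℕ) (x : ℕ → Fin d → ℝ) : 0 ≤ pathLength T x :=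
  sum_nonneg fun _ _ => by positivity

theorem expertVariation_nonneg {d : ℕ} (T : ℕ) (xhat util : ℕ → Fin d → ℝ) :
    0 ≤ expertVariation T xhat util :=
  sum_nonneg fun _ _ => sum_nonneg fun _ _ => by positivity

theorem l1norm_nonneg {d : ℕ} (v : Fin d → ℝ) : 0 ≤ l1norm v :=
  sum_nonneg fun _ _ => abs_nonneg _

theorem l1norm_sub_le_two {d : ℕ} {p q : Fin d → ℝ} (hp : p ∈ stdSimplex ℝ (Fin d))
    (hq : q ∈ stdSimplex ℝ (Fin d)) : l1norm (p - q) ≤ 2 := by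
  have : ∀ a, |(p - q) a| ≤ p a + q a := fun a => by
    rw [Pi.sub_apply, abs_le]
    constructor <;> linarith [hp.1 a, hq.1 a]
  refine (sum_le_sum fun a _ => this a).trans ?_
  rw [sum_add_distrib, hp.2, hq.2]
  norm_num

theorem stdSimplex_apply_le_one {d : ℕ} {p : Fin d → ℝ} (hp : p ∈ stdSimplex ℝ (Fin d))
    (a : Fin d) : p a ≤ 1 := by
  rw [← hp.2]
  exact single_le_sum (fun j _ => hp.1 j) (mem_univ a)

theorem sum_pred_le {f : ℕ → ℝ} {T : ℕ} (hf : ∀ t ∈ Icc 1 T, 0 ≤ f t) :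
    ∑ t ∈ Icc 2 T, f (t - 1) ≤ ∑ t ∈ Icc 1 T, f t := by
  have : ∑ t ∈ Icc 2 T, f (t - 1) = ∑ t ∈ Icc 1 (T - 1), f t := by
    refine sum_nbij' (fun t => t - 1) (fun t => t + 1) ?_ ?_ ?_ ?_ ?_ <;>
      intro t ht <;> simp only [mem_Icc] at ht ⊢ <;> omega
  rw [this]
  exact sum_le_sum_of_subset_of_nonneg (Icc_subset_Icc_right (Nat.sub_le T 1))
    fun t ht _ => hf t ht

theorem sum_tail_le {f : ℕ → ℝ} {T : ℕ} (hf : ∀ t ∈ Icc 1 T, 0 ≤ f t) :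
    ∑ t ∈ Icc 2 T, f t ≤ ∑ t ∈ Icc 1 T, f t :=
  sum_le_sum_of_subset_of_nonneg (Icc_subset_Icc_left (by norm_num)) fun t ht _ => hf t ht

/-- The stationary distribution moves no further than the barrier divergences allow. If one of the
divergences is not small, the bound holds because two distributions are at distance at most `2`. -/
theorem l1norm_stationary_sq_le {d : ℕ} {Q Q' G : Matrix (Fin d) (Fin d) ℝ} {π π' : Fin d → ℝ}
    (h : IsPositiveChain Q π) (h' : IsPositiveChain Q' π') (hG : ∀ a b, 0 < G a b) :
    l1norm (π' - π) ^ 2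
      ≤ 256 * d * ∑ a, (barrierDiv (G a) (Q a) + barrierDiv (Q' a) (G a)) := by
  set D : Fin d → ℝ := fun a => barrierDiv (G a) (Q a) + barrierDiv (Q' a) (G a) with hD
  have hD1 : ∀ a, 0 ≤ barrierDiv (G a) (Q a) := fun a => barrierDiv_nonneg (hG a) (h.pos a)
  have hD2 : ∀ a, 0 ≤ barrierDiv (Q' a) (G a) := fun a => barrierDiv_nonneg (h'.pos a) (hG a)
  have hD0 : ∀ a, 0 ≤ D a := fun a => add_nonneg (hD1 a) (hD2 a)
  by_cases hsmall : ∀ a, 4 * D a < 1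
  · have hlog : ∀ {r E : ℝ}, min 1 (r ^ 2) ≤ 4 * E → 4 * E < 1 → |r| ≤ 2 * √E := by
      intro r E h1 h2
      have h3 : r ^ 2 ≤ 4 * E := (min_le_iff.1 h1).resolve_left (not_le.2 h2)
      have h4 := Real.abs_le_sqrt h3
      rwa [Real.sqrt_mul (by norm_num), (by norm_num : (4 : ℝ) = 2 ^ 2),
        Real.sqrt_sq (by norm_num)] at h4
    have hrat : ∀ a b, |Real.log (Q' a b / Q a b)| ≤ 4 * √(D a) := by
      intro a b
      have e1 := hlog (min_one_log_sq_le_barrierDiv (hG a) (h.pos a) b)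
        (by have := hsmall a; have := hD2 a; simp only [hD] at *; linarith)
      have e2 := hlog (min_one_log_sq_le_barrierDiv (h'.pos a) (hG a) b)
        (by have := hsmall a; have := hD1 a; simp only [hD] at *; linarith)
      have e3 : √(barrierDiv (G a) (Q a)) ≤ √(D a) :=
        Real.sqrt_le_sqrt (le_add_of_nonneg_right (hD2 a))
      have e4 : √(barrierDiv (Q' a) (G a)) ≤ √(D a) :=
        Real.sqrt_le_sqrt (le_add_of_nonneg_left (hD1 a))
      have e5 : Real.log (Q' a b / Q a b)
          = Real.log (Q' a b / G a b) + Real.log (G a b / Q a b) := by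
        rw [← Real.log_mul (div_pos (h'.pos a b) (hG a b)).ne' (div_pos (hG a b) (h.pos a b)).ne',
          div_mul_div_cancel₀ (hG a b).ne']
      rw [e5]
      refine (abs_add_le _ _).trans ?_
      linarith
    have hexp : ∀ {p q δ : ℝ}, 0 < p → 0 < q → |Real.log (p / q)| ≤ δ → p ≤ Real.exp δ * q := by
      intro p q δ hp hq hle
      rw [← div_le_iff₀ hq, ← Real.log_le_iff_le_exp (div_pos hp hq)]
      exact (abs_le.1 hle).2
    have h1 := h.sum_abs_sub_le h' (δ := fun a => 4 * √(D a)) (fun a => by positivity)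
      (fun a b => hexp (h'.pos a b) (h.pos a b) (hrat a b))
      (fun a b => hexp (h.pos a b) (h'.pos a b) (by
        rw [← inv_div, Real.log_inv, abs_neg]
        exact hrat a b))
    have h2 : l1norm (π' - π) ≤ 16 * ∑ a, √(D a) := by
      rw [← mul_sum] at h1
      refine le_trans (le_of_eq rfl) (h1.trans (le_of_eq (by ring)))
    have h3 : (∑ a, √(D a)) ^ 2 ≤ d * ∑ a, D a := by
      have := sq_sum_le_card_mul_sum_sq (s := univ) (f := fun a => √(D a))
      simpa [Real.sq_sqrt (hD0 _)] using this
    calc l1norm (π' - π) ^ 2 ≤ (16 * ∑ a, √(D a)) ^ 2 := by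
          gcongr
          exact l1norm_nonneg _
      _ = 256 * (∑ a, √(D a)) ^ 2 := by ring
      _ ≤ 256 * (d * ∑ a, D a) := by gcongr
      _ = _ := by ring
  · push Not at hsmall
    obtain ⟨a, ha⟩ := hsmall
    have hd : (1 : ℝ) ≤ d := by exact_mod_cast a.pos
    have h1 : D a ≤ ∑ a, D a := single_le_sum (fun j _ => hD0 j) (mem_univ a)
    have h2 := l1norm_sub_le_two h'.mem h.mem
    have h3 := l1norm_nonneg (π' - π)
    nlinarith

section Player

variable {n T d : ℕ} {util xhat : ℕ → Fin d → ℝ}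

theorem norm_expertUtility_le (hu : ∀ t ∈ Icc 1 T, ‖util t‖ ≤ 1)
    (hx : ∀ t ∈ Icc 1 T, xhat t ∈ stdSimplex ℝ (Fin d)) (a : Fin d) {t : ℕ} (ht : t ∈ Icc 1 T) :
    ‖expertUtility xhat util a t‖ ≤ xhat t a := by
  have h1 : t ≠ 0 := by rw [mem_Icc] at ht; omega
  rw [expertUtility, if_neg h1, norm_smul, Real.norm_of_nonneg ((hx t ht).1 a)]
  exact mul_le_of_le_one_right ((hx t ht).1 a) (hu t ht)

theorem expertUtility_zero (a : Fin d) : expertUtility xhat util a 0 = 0 := if_pos rfl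

theorem norm_expertUtility_le_one (hu : ∀ t ∈ Icc 1 T, ‖util t‖ ≤ 1)
    (hx : ∀ t ∈ Icc 1 T, xhat t ∈ stdSimplex ℝ (Fin d)) (a : Fin d) {t : ℕ} (ht : t ≤ T) :
    ‖expertUtility xhat util a t‖ ≤ 1 := by
  rcases Nat.eq_zero_or_pos t with rfl | h
  · rw [expertUtility_zero, norm_zero]; exact zero_le_one
  · have ht' : t ∈ Icc 1 T := mem_Icc.2 ⟨h, ht⟩
    exact (norm_expertUtility_le hu hx a ht').trans (stdSimplex_apply_le_one (hx t ht') a)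

/-- The Blum–Mansour decomposition: by stationarity, swap regret is the sum of the regrets of the
experts. -/
theorem swapRegretAt_eq_sum {Q : ℕ → Matrix (Fin d) (Fin d) ℝ}
    (hQ : ∀ t ∈ Icc 1 T, (Q t)ᵀ *ᵥ xhat t = xhat t) (M : Matrix (Fin d) (Fin d) ℝ) :
    swapRegretAt T xhat util M
      = ∑ a, ∑ t ∈ Icc 1 T, (M a - Q t a) ⬝ᵥ expertUtility xhat util a t := by
  rw [sum_comm, swapRegretAt]
  refine sum_congr rfl fun t ht => ?_
  have h1 : t ≠ 0 := by rw [mem_Icc] at ht; omega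
  have h2 : xhat t ⬝ᵥ util t = xhat t ⬝ᵥ (Q t *ᵥ util t) := by
    rw [dotProduct_mulVec, ← mulVec_transpose, hQ t ht]
  rw [dotProduct_sub, h2, ← dotProduct_sub, dotProduct]
  refine sum_congr rfl fun a _ => ?_
  rw [expertUtility, if_neg h1, dotProduct_smul, sub_dotProduct, smul_eq_mul]
  rfl

/-- Swap regret bound of a single player. The negative term comes from the divergences in
`expert_regret_le` through `l1norm_stationary_sq_le`. -/
theorem swapRegretAt_le (hn : 1 ≤ n) (hT : 2 ≤ T) (hd : 1 ≤ d)
    (halg : IsAlgorithmOutput n T util xhat) (hu : ∀ t ∈ Icc 1 T, ‖util t‖ ≤ 1)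
    {M : Matrix (Fin d) (Fin d) ℝ} (hM : M ∈ rowStochastic ℝ (Fin d)) :
    swapRegretAt T xhat util M ≤ 2 * d + 256 * n * √d * (d * (d * Real.log T))
      + 6 * (d * √(Real.log T * (4 * d + expertVariation T xhat util)))
      - n / (2 * √d) * pathLength T xhat := by
  obtain ⟨Q, hQ⟩ := halg
  have hd0 : (0 : ℝ) < d := by exact_mod_cast hd
  have hL : 0 < Real.log T := Real.log_pos (by exact_mod_cast hT)
  have hx : ∀ t ∈ Icc 1 T, xhat t ∈ stdSimplex ℝ (Fin d) := fun t ht => (hQ t ht).2.1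
  have hM' : ∀ a, M a ∈ stdSimplex ℝ (Fin d) := fun a =>
    ⟨(mem_rowStochastic_iff_sum.1 hM).1 a, (mem_rowStochastic_iff_sum.1 hM).2 a⟩
  have hw : ∀ a, ∀ t ≤ T, ‖expertUtility xhat util a t‖ ≤ 1 := fun a t ht =>
    norm_expertUtility_le_one hu hx a ht
  have hexp := fun a => expert_regret_le hn hT hd (w := expertUtility xhat util a)
    (y := fun t => Q t a) (fun t ht => (hQ t ht).1 a) (fun t ht => hw a t (mem_Icc.1 ht).2)
    (fun t ht => by
      have h1 := hw a t (mem_Icc.1 ht).2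
      have h2 := hw a (t - 1) (by have := (mem_Icc.1 ht).2; omega)
      exact (norm_sub_le _ _).trans (by linarith))
  choose g hg hreg using hexp
  rw [swapRegretAt_eq_sum (fun t ht => (hQ t ht).2.2)]
  refine (sum_le_sum fun a _ => hreg a (M a) (hM' a)).trans ?_
  have hchain : ∀ t ∈ Icc 1 T, IsPositiveChain (Q t) (xhat t) := fun t ht =>
    { pos := fun a => ((hQ t ht).1 a).1.2
      row_sum := fun a => ((hQ t ht).1 a).1.1.2
      mem := hx t ht
      stationary := fun b => by
        have := congrFun (hQ t ht).2.2 b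
        rw [mulVec_transpose] at this
        exact this }
  -- The divergences along `Q (t - 1) a → g a t → Q t a` control the movement of `xhat`.
  have hpath : pathLength T xhat ≤ 256 * d * ∑ a, ∑ t ∈ Icc 1 T,
      (barrierDiv (g a (t + 1)) (Q t a) + barrierDiv (Q t a) (g a t)) := by
    rw [sum_comm]
    have h1 : ∀ t ∈ Icc 1 T, 0 ≤ ∑ a, barrierDiv (g a (t + 1)) (Q t a) := fun t ht =>
      sum_nonneg fun a _ => barrierDiv_nonneg (hg a _).2 ((hchain t ht).pos a)
    have h2 : ∀ t ∈ Icc 1 T, 0 ≤ ∑ a, barrierDiv (Q t a) (g a t) := fun t ht =>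
      sum_nonneg fun a _ => barrierDiv_nonneg ((hchain t ht).pos a) (hg a _).2
    calc pathLength T xhat
        ≤ ∑ t ∈ Icc 2 T, 256 * d * (∑ a, barrierDiv (g a (t - 1 + 1)) (Q (t - 1) a)
            + ∑ a, barrierDiv (Q t a) (g a t)) := by
          refine sum_le_sum fun t ht => ?_
          rw [mem_Icc] at ht
          have e1 := l1norm_stationary_sq_le (G := fun a => g a t)
            (hchain (t - 1) (mem_Icc.2 ⟨by omega, by omega⟩))
            (hchain t (mem_Icc.2 ⟨by omega, by omega⟩)) (fun a => (hg a t).2)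
          rw [sum_add_distrib] at e1
          rwa [Nat.sub_add_cancel (by omega : 1 ≤ t)]
      _ = 256 * d * (∑ t ∈ Icc 2 T, ∑ a, barrierDiv (g a (t - 1 + 1)) (Q (t - 1) a)
            + ∑ t ∈ Icc 2 T, ∑ a, barrierDiv (Q t a) (g a t)) := by
          rw [← mul_sum, sum_add_distrib]
      _ ≤ 256 * d * (∑ t ∈ Icc 1 T, ∑ a, barrierDiv (g a (t + 1)) (Q t a)
            + ∑ t ∈ Icc 1 T, ∑ a, barrierDiv (Q t a) (g a t)) := by
          exact mul_le_mul_of_nonneg_left (add_le_add (sum_pred_le h1) (sum_tail_le h2))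
            (by positivity)
      _ = _ := by
          rw [← sum_add_distrib]
          simp only [sum_add_distrib]
  -- Cauchy–Schwarz over the experts
  have hsqrt : ∑ a, √(d * Real.log T * (4 + ∑ t ∈ Icc 1 T,
        ‖expertUtility xhat util a t - expertUtility xhat util a (t - 1)‖ ^ 2))
      ≤ d * √(Real.log T * (4 * d + expertVariation T xhat util)) := by
    refine Real.le_sqrt_of_sq_le (sq_sum_le_card_mul_sum_sq (s := univ)) |>.trans ?_
    rw [← Real.sqrt_sq hd0.le, ← Real.sqrt_mul (by positivity)]
    apply Real.sqrt_le_sqrt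
    rw [Real.sqrt_sq hd0.le]
    have e1 : ∀ a : Fin d, √(d * Real.log T * (4 + ∑ t ∈ Icc 1 T,
        ‖expertUtility xhat util a t - expertUtility xhat util a (t - 1)‖ ^ 2)) ^ 2
        = d * Real.log T * (4 + ∑ t ∈ Icc 1 T,
        ‖expertUtility xhat util a t - expertUtility xhat util a (t - 1)‖ ^ 2) := fun a => by
      rw [Real.sq_sqrt]
      have : 0 ≤ ∑ t ∈ Icc 1 T,
        ‖expertUtility xhat util a t - expertUtility xhat util a (t - 1)‖ ^ 2 :=
        sum_nonneg fun _ _ => by positivity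
      positivity
    simp only [e1]
    rw [← mul_sum, sum_add_distrib]
    simp only [sum_const, card_univ, Fintype.card_fin, nsmul_eq_mul, expertVariation]
    exact le_of_eq (by ring)
  have hneg : n / (2 * √d) * pathLength T xhat ≤ 128 * n * √d * ∑ a, ∑ t ∈ Icc 1 T,
      (barrierDiv (g a (t + 1)) (Q t a) + barrierDiv (Q t a) (g a t)) := by
    have h1 : (0 : ℝ) < √d := Real.sqrt_pos.2 hd0
    have h2 : √(d : ℝ) ^ 2 = d := Real.sq_sqrt hd0.le
    refine (mul_le_mul_of_nonneg_left hpath (by positivity)).trans (le_of_eq ?_)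
    rw [div_mul_eq_mul_div, div_eq_iff (by positivity)]
    linear_combination (-256 * n * ∑ a, ∑ t ∈ Icc 1 T,
      (barrierDiv (g a (t + 1)) (Q t a) + barrierDiv (Q t a) (g a t))) * h2
  rw [sum_sub_distrib, sum_add_distrib, ← mul_sum, ← mul_sum]
  simp only [sum_const, card_univ, Fintype.card_fin, nsmul_eq_mul]
  have e : (d : ℝ) * (2 + 256 * n * √d * (d * Real.log T))
    = 2 * d + 256 * n * √d * (d * (d * Real.log T)) := by ring
  linarith

theorem expertVariation_le_mul (hu : ∀ t ∈ Icc 1 T, ‖util t‖ ≤ 1)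
    (hx : ∀ t ∈ Icc 1 T, xhat t ∈ stdSimplex ℝ (Fin d)) :
    expertVariation T xhat util ≤ 4 * T := by
  have hsq : ∀ t ≤ T, ∑ a, ‖expertUtility xhat util a t‖ ^ 2 ≤ 1 := by
    intro t ht
    rcases Nat.eq_zero_or_pos t with rfl | h
    · simp [expertUtility_zero]
    · have ht' : t ∈ Icc 1 T := mem_Icc.2 ⟨h, ht⟩
      rw [← (hx t ht').2]
      refine sum_le_sum fun a _ => ?_
      have h1 := norm_expertUtility_le hu hx a ht'
      nlinarith [norm_nonneg (expertUtility xhat util a t), stdSimplex_apply_le_one (hx t ht') a]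
  have key : ∀ t ∈ Icc 1 T,
      ∑ a, ‖expertUtility xhat util a t - expertUtility xhat util a (t - 1)‖ ^ 2 ≤ 4 := by
    intro t ht
    rw [mem_Icc] at ht
    have h1 : ∀ a, ‖expertUtility xhat util a t - expertUtility xhat util a (t - 1)‖ ^ 2 ≤
        2 * ‖expertUtility xhat util a t‖ ^ 2 + 2 * ‖expertUtility xhat util a (t - 1)‖ ^ 2 := by
      intro a
      have := norm_sub_le (expertUtility xhat util a t) (expertUtility xhat util a (t - 1))
      nlinarith [norm_nonneg (expertUtility xhat util a t - expertUtility xhat util a (t - 1)),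
        sq_nonneg (‖expertUtility xhat util a t‖ - ‖expertUtility xhat util a (t - 1)‖)]
    refine (sum_le_sum fun a _ => h1 a).trans ?_
    rw [sum_add_distrib, ← mul_sum, ← mul_sum]
    linarith [hsq t ht.2, hsq (t - 1) (by omega)]
  rw [expertVariation, sum_comm]
  refine (sum_le_sum key).trans (le_of_eq ?_)
  simp [mul_comm]

theorem expertVariation_le (hT : 1 ≤ T) (hu : ∀ t ∈ Icc 1 T, ‖util t‖ ≤ 1)
    (hx : ∀ t ∈ Icc 1 T, xhat t ∈ stdSimplex ℝ (Fin d)) :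
    expertVariation T xhat util ≤ 1 + 2 * variation T util + 2 * pathLength T xhat := by
  have hsum : ∀ {f : Fin d → ℝ}, (∀ a, 0 ≤ f a) → ∑ a, f a ^ 2 ≤ (∑ a, f a) ^ 2 := fun {f} hf => by
    rw [sq (∑ a, f a), mul_sum]
    refine sum_le_sum fun a _ => ?_
    rw [sq]
    exact mul_le_mul_of_nonneg_right (single_le_sum (fun j _ => hf j) (mem_univ a)) (hf a)
  rw [expertVariation, sum_comm, ← add_sum_Ioc_eq_sum_Icc hT, add_assoc]
  have h1 : ∑ a, ‖expertUtility xhat util a 1 - expertUtility xhat util a (1 - 1)‖ ^ 2 ≤ 1 := by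
    have hmem : 1 ∈ Icc 1 T := mem_Icc.2 ⟨le_rfl, hT⟩
    have e := hsum fun a => (hx 1 hmem).1 a
    rw [(hx 1 hmem).2, one_pow] at e
    refine le_trans (sum_le_sum fun a _ => ?_) e
    rw [Nat.sub_self, expertUtility_zero, sub_zero]
    exact pow_le_pow_left₀ (norm_nonneg _) (norm_expertUtility_le hu hx a hmem) 2
  refine add_le_add h1 ?_
  rw [variation, pathLength, mul_sum, mul_sum, ← sum_add_distrib]
  refine sum_le_sum fun t ht => ?_
  have ht' : 2 ≤ t ∧ t ≤ T := mem_Icc.1 ht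
  have hm : t ∈ Icc 1 T := mem_Icc.2 ⟨by omega, by omega⟩
  have hm' : t - 1 ∈ Icc 1 T := mem_Icc.2 ⟨by omega, by omega⟩
  have key : ∀ a, ‖expertUtility xhat util a t - expertUtility xhat util a (t - 1)‖ ^ 2 ≤
      2 * ‖util t - util (t - 1)‖ ^ 2 * xhat t a ^ 2 + 2 * |(xhat t - xhat (t - 1)) a| ^ 2 := by
    intro a
    have e1 : expertUtility xhat util a t - expertUtility xhat util a (t - 1)
        = xhat t a • (util t - util (t - 1)) + (xhat t - xhat (t - 1)) a • util (t - 1) := by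
      rw [expertUtility, expertUtility, if_neg (by omega), if_neg (by omega), Pi.sub_apply,
        smul_sub, sub_smul]
      abel
    have e2 : ‖expertUtility xhat util a t - expertUtility xhat util a (t - 1)‖
        ≤ xhat t a * ‖util t - util (t - 1)‖ + |(xhat t - xhat (t - 1)) a| := by
      rw [e1]
      refine (norm_add_le _ _).trans (add_le_add ?_ ?_)
      · rw [norm_smul, Real.norm_of_nonneg ((hx t hm).1 a)]
      · rw [norm_smul, Real.norm_eq_abs]
        exact mul_le_of_le_one_right (abs_nonneg _) (hu _ hm')
    refine (pow_le_pow_left₀ (norm_nonneg _) e2 2).trans ?_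
    nlinarith [sq_nonneg (xhat t a * ‖util t - util (t - 1)‖ - |(xhat t - xhat (t - 1)) a|)]
  refine (sum_le_sum fun a _ => key a).trans ?_
  rw [sum_add_distrib, ← mul_sum, ← mul_sum]
  have e3 := hsum fun a => (hx t hm).1 a
  rw [(hx t hm).2, one_pow] at e3
  have e4 := hsum fun a => abs_nonneg ((xhat t - xhat (t - 1)) a)
  refine add_le_add ?_ (mul_le_mul_of_nonneg_left e4 (by norm_num))
  exact mul_le_of_le_one_right (by positivity) e3

/-- A version of `swapRegretAt_le` in which the lower-order terms are absorbed into
`n d^{5/2} log T`. -/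
theorem swapRegretAt_le' (hn : 2 ≤ n) (hT : 2 ≤ T) (hd : 1 ≤ d)
    (halg : IsAlgorithmOutput n T util xhat) (hu : ∀ t ∈ Icc 1 T, ‖util t‖ ≤ 1)
    {M : Matrix (Fin d) (Fin d) ℝ} (hM : M ∈ rowStochastic ℝ (Fin d)) :
    swapRegretAt T xhat util M ≤ 300 * (n * (d ^ 2 * √d) * Real.log T)
      + 6 * (d * √(Real.log T * expertVariation T xhat util))
      - n / (2 * √d) * pathLength T xhat := by
  have h := swapRegretAt_le (by omega) hT hd halg hu hM
  have hd0 : (1 : ℝ) ≤ d := by exact_mod_cast hd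
  have hd1 : (1 : ℝ) ≤ √d := Real.one_le_sqrt.2 hd0
  have hd2 : √(d : ℝ) ^ 2 = d := Real.sq_sqrt (by linarith)
  have hn0 : (2 : ℝ) ≤ n := by exact_mod_cast hn
  have hL : 1 / 2 ≤ Real.log T := by
    have h1 : Real.log 2 ≤ Real.log T := Real.log_le_log two_pos (by exact_mod_cast hT)
    linarith [Real.log_two_gt_d9]
  set L := Real.log T with hLdef
  set P := expertVariation T xhat util with hP
  have hP0 : 0 ≤ P := expertVariation_nonneg _ _ _
  have h1 : √(L * (4 * d + P)) ≤ 2 * √d * √L + √(L * P) := by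
    refine Real.sqrt_le_iff.2 ⟨by positivity, ?_⟩
    have e1 := Real.sq_sqrt (mul_nonneg (by linarith : 0 ≤ L) hP0)
    have e2 := Real.sq_sqrt (by linarith : 0 ≤ L)
    have e3 : 0 ≤ 4 * √d * √L * √(L * P) := by positivity
    calc L * (4 * d + P) = 4 * √(d : ℝ) ^ 2 * √L ^ 2 + √(L * P) ^ 2 := by
          rw [e1, e2, hd2]; ring
      _ ≤ _ := by linarith
  have h2 : √L ≤ 2 * L := by
    refine Real.sqrt_le_iff.2 ⟨by linarith, by nlinarith⟩
  set B := (n : ℝ) * (d ^ 2 * √d) * L with hB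
  have h3 : 2 * (d : ℝ) ≤ 2 * B := by
    have e1 : (d : ℝ) * 1 ≤ d * (d * √d * (n * L)) := by
      refine mul_le_mul_of_nonneg_left ?_ (by linarith)
      have : 1 ≤ d * √(d : ℝ) := by nlinarith
      have : 1 ≤ n * L := by nlinarith
      nlinarith
    rw [hB]
    linarith
  have h4 : 6 * (d * (2 * √d * √L)) ≤ 12 * B := by
    have e1 : (d : ℝ) * √d * √L ≤ d * √d * (d * (n * L)) := by
      refine mul_le_mul_of_nonneg_left (h2.trans ?_) (by positivity)
      have : 2 * L ≤ n * L := by nlinarith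
      nlinarith
    rw [hB]
    linarith
  have h5 : 256 * n * √d * (d * (d * L)) = 256 * B := by rw [hB]; ring
  have h6 : (d : ℝ) * √(L * (4 * d + P)) ≤ d * (2 * √d * √L) + d * √(L * P) := by
    rw [← mul_add]
    exact mul_le_mul_of_nonneg_left h1 (by linarith)
  have h7 : 0 ≤ B := by positivity
  linarith

end Player

/-! ### Expected utilities are Lipschitz in the strategies -/

section Product

variable {n : ℕ} {m : Fin n → ℕ}

theorem prod_update_apply (h : ∀ j, Fin (m j) → ℝ) (k : Fin n) (r : Fin (m k) → ℝ)
    (b : ∀ j, Fin (m j)) :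
    ∏ j, Function.update h k r j (b j) = r (b k) * ∏ j ∈ univ.erase k, h j (b j) := by
  rw [← mul_prod_erase univ _ (mem_univ k), Function.update_self]
  congr 1
  exact prod_congr rfl fun j hj => by rw [Function.update_of_ne (ne_of_mem_erase hj)]

theorem sum_prod_apply (h : ∀ j, Fin (m j) → ℝ) :
    ∑ b : ∀ j, Fin (m j), ∏ j, h j (b j) = ∏ j, ∑ c, h j c := by
  rw [prod_univ_sum, Fintype.piFinset_univ]

theorem sum_abs_prod_update_sub {h : ∀ j, Fin (m j) → ℝ}
    (hh : ∀ j, h j ∈ stdSimplex ℝ (Fin (m j))) (k : Fin n) (r : Fin (m k) → ℝ) :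
    ∑ b : ∀ j, Fin (m j), |∏ j, Function.update h k r j (b j) - ∏ j, h j (b j)|
      = l1norm (r - h k) := by
  have h1 : ∀ b : ∀ j, Fin (m j), |∏ j, Function.update h k r j (b j) - ∏ j, h j (b j)|
      = ∏ j, Function.update h k (fun c => |(r - h k) c|) j (b j) := by
    intro b
    rw [prod_update_apply, prod_update_apply, ← mul_prod_erase univ _ (mem_univ k), ← sub_mul,
      abs_mul, abs_of_nonneg (prod_nonneg fun j _ => (hh j).1 (b j))]
    rfl
  simp only [h1]
  rw [sum_prod_apply, ← mul_prod_erase univ _ (mem_univ k), prod_eq_one, mul_one,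
    Function.update_self]
  · rfl
  · intro j hj
    rw [Function.update_of_ne (ne_of_mem_erase hj)]
    exact (hh j).2

/-- Product distributions differ in `ℓ₁` by at most the sum of the differences of their factors. -/
theorem sum_abs_prod_sub_le {p q : ∀ j, Fin (m j) → ℝ}
    (hp : ∀ j, p j ∈ stdSimplex ℝ (Fin (m j))) (hq : ∀ j, q j ∈ stdSimplex ℝ (Fin (m j))) :
    ∑ b : ∀ j, Fin (m j), |∏ j, p j (b j) - ∏ j, q j (b j)| ≤ ∑ j, l1norm (p j - q j) := by
  have key : ∀ s : Finset (Fin n),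
      ∑ b : ∀ j, Fin (m j), |∏ j, s.piecewise p q j (b j) - ∏ j, q j (b j)|
        ≤ ∑ j ∈ s, l1norm (p j - q j) := by
    intro s
    induction s using Finset.induction_on with
    | empty => simp
    | insert k s hk ih =>
      have hmem : ∀ j, s.piecewise p q j ∈ stdSimplex ℝ (Fin (m j)) := by
        intro j
        by_cases hj : j ∈ s
        · rw [piecewise_eq_of_mem _ _ _ hj]; exact hp j
        · rw [piecewise_eq_of_notMem _ _ _ hj]; exact hq j
      have h1 := sum_abs_prod_update_sub hmem k (p k)
      rw [piecewise_eq_of_notMem _ _ _ hk] at h1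
      rw [sum_insert hk, ← h1, piecewise_insert]
      refine le_trans ?_ (add_le_add_right ih _)
      rw [← sum_add_distrib]
      exact sum_le_sum fun b _ => abs_sub_le _ _ _
  simpa using key univ

theorem update_single_mem {x : ∀ j, Fin (m j) → ℝ}
    (hx : ∀ j, x j ∈ stdSimplex ℝ (Fin (m j))) (i : Fin n) (a : Fin (m i)) (j : Fin n) :
    Function.update x i (Pi.single a 1) j ∈ stdSimplex ℝ (Fin (m j)) := by
  by_cases h : j = i
  · subst h; rw [Function.update_self]; exact single_mem_stdSimplex ℝ a
  · rw [Function.update_of_ne h]; exact hx j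

theorem expectedUtility_eq (u : Fin n → (∀ j, Fin (m j)) → ℝ) (x : ∀ j, Fin (m j) → ℝ)
    (i : Fin n) (a : Fin (m i)) :
    expectedUtility u x i a
      = ∑ b : ∀ j, Fin (m j), (∏ j, Function.update x i (Pi.single a 1) j (b j)) * u i b := by
  rw [expectedUtility, sum_filter]
  refine sum_congr rfl fun b _ => ?_
  rw [prod_update_apply, Pi.single_apply]
  split_ifs <;> simp

theorem norm_expectedUtility_sub_le {u : Fin n → (∀ j, Fin (m j)) → ℝ}
    (hu : ∀ i b, u i b ∈ Set.Icc (-1 : ℝ) 1) {x y : ∀ j, Fin (m j) → ℝ}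
    (hx : ∀ j, x j ∈ stdSimplex ℝ (Fin (m j))) (hy : ∀ j, y j ∈ stdSimplex ℝ (Fin (m j)))
    (i : Fin n) :
    ‖expectedUtility u x i - expectedUtility u y i‖ ≤ ∑ j, l1norm (x j - y j) := by
  refine (pi_norm_le_iff_of_nonneg (sum_nonneg fun j _ => l1norm_nonneg _)).2 fun a => ?_
  rw [Pi.sub_apply, expectedUtility_eq, expectedUtility_eq, ← sum_sub_distrib, Real.norm_eq_abs]
  refine (abs_sum_le_sum_abs _ _).trans (le_trans (sum_le_sum fun b _ => ?_)
    ((sum_abs_prod_sub_le (update_single_mem hx i a) (update_single_mem hy i a)).trans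
      (sum_le_sum fun j _ => ?_)))
  · rw [← sub_mul, abs_mul]
    exact mul_le_of_le_one_right (abs_nonneg _) (abs_le.2 (hu i b))
  · by_cases h : j = i
    · subst h
      simp only [Function.update_self, sub_self]
      simpa [l1norm] using l1norm_nonneg (x j - y j)
    · rw [Function.update_of_ne h, Function.update_of_ne h]

theorem norm_expectedUtility_le_one {u : Fin n → (∀ j, Fin (m j)) → ℝ}
    (hu : ∀ i b, u i b ∈ Set.Icc (-1 : ℝ) 1) {x : ∀ j, Fin (m j) → ℝ}
    (hx : ∀ j, x j ∈ stdSimplex ℝ (Fin (m j))) (i : Fin n) : ‖expectedUtility u x i‖ ≤ 1 := by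
  refine (pi_norm_le_iff_of_nonneg zero_le_one).2 fun a => ?_
  have hmem := update_single_mem hx i a
  have h1 : ∑ b : ∀ j, Fin (m j), ∏ j, Function.update x i (Pi.single a 1) j (b j) = 1 := by
    rw [sum_prod_apply]
    exact prod_eq_one fun j _ => (hmem j).2
  rw [expectedUtility_eq, Real.norm_eq_abs]
  refine (abs_sum_le_sum_abs _ _).trans ((sum_le_sum fun b _ => ?_).trans h1.le)
  have h2 : 0 ≤ ∏ j, Function.update x i (Pi.single a 1) j (b j) :=
    prod_nonneg fun j _ => (hmem j).1 (b j)
  rw [abs_mul, abs_of_nonneg h2]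
  exact mul_le_of_le_one_right h2 (abs_le.2 (hu i b))

end Product

/-! ### Effect of corruption -/

/-- Perturbations `c t` enter the sum of squares only through their sum, because they are bounded:
`(c t + c (t - 1))² ≤ 4 (c t + c (t - 1))`. -/
theorem sum_sq_le_of_perturbed {T : ℕ} {a b c : ℕ → ℝ} {C : ℝ} (ha : ∀ t ∈ Icc 2 T, 0 ≤ a t)
    (hc : ∀ t ∈ Icc 1 T, 0 ≤ c t ∧ c t ≤ 2) (hC : ∑ t ∈ Icc 1 T, c t ≤ C)
    (h : ∀ t ∈ Icc 2 T, a t ≤ b t + c t + c (t - 1)) :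
    ∑ t ∈ Icc 2 T, a t ^ 2 ≤ 2 * ∑ t ∈ Icc 2 T, b t ^ 2 + 16 * C := by
  have key : ∀ t ∈ Icc 2 T, a t ^ 2 ≤ 2 * b t ^ 2 + 8 * (c t + c (t - 1)) := by
    intro t ht
    have h0 := h t ht
    have h1 := ha t ht
    rw [mem_Icc] at ht
    obtain ⟨h2, h3⟩ := hc t (mem_Icc.2 ⟨by omega, by omega⟩)
    obtain ⟨h4, h5⟩ := hc (t - 1) (mem_Icc.2 ⟨by omega, by omega⟩)
    calc a t ^ 2 ≤ (b t + (c t + c (t - 1))) ^ 2 := pow_le_pow_left₀ h1 (by linarith) 2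
      _ ≤ 2 * b t ^ 2 + 2 * (c t + c (t - 1)) ^ 2 := by
        nlinarith [sq_nonneg (b t - (c t + c (t - 1)))]
      _ ≤ _ := by nlinarith
  refine (sum_le_sum key).trans ?_
  rw [sum_add_distrib, ← mul_sum, ← mul_sum, sum_add_distrib]
  have h1 := sum_pred_le fun t ht => (hc t ht).1
  have h2 := sum_tail_le fun t ht => (hc t ht).1
  linarith

theorem l1norm_add_le {d : ℕ} (v w : Fin d → ℝ) : l1norm (v + w) ≤ l1norm v + l1norm w := by
  rw [l1norm, l1norm, l1norm, ← sum_add_distrib]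
  exact sum_le_sum fun a _ => abs_add_le _ _

theorem l1norm_neg {d : ℕ} (v : Fin d → ℝ) : l1norm (-v) = l1norm v := by
  simp [l1norm]

theorem pathLength_le_of_corruption {d T : ℕ} {x xhat : ℕ → Fin d → ℝ} {C : ℝ}
    (hx : ∀ t ∈ Icc 1 T, x t ∈ stdSimplex ℝ (Fin d))
    (hxhat : ∀ t ∈ Icc 1 T, xhat t ∈ stdSimplex ℝ (Fin d))
    (hC : ∑ t ∈ Icc 1 T, l1norm (x t - xhat t) ≤ C) :
    pathLength T x ≤ 2 * pathLength T xhat + 16 * C := by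
  refine sum_sq_le_of_perturbed (fun t _ => l1norm_nonneg _)
    (fun t ht => ⟨l1norm_nonneg _, l1norm_sub_le_two (hx t ht) (hxhat t ht)⟩) hC fun t _ => ?_
  have h1 : x t - x (t - 1)
      = (xhat t - xhat (t - 1)) + (x t - xhat t) + -(x (t - 1) - xhat (t - 1)) := by abel
  rw [h1, ← l1norm_neg (x (t - 1) - xhat (t - 1))]
  exact (l1norm_add_le _ _).trans (add_le_add_left (l1norm_add_le _ _) _)

theorem variation_le_of_corruption {d T : ℕ} {v util : ℕ → Fin d → ℝ} {C : ℝ}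
    (hv : ∀ t ∈ Icc 1 T, ‖v t‖ ≤ 1) (hu : ∀ t ∈ Icc 1 T, ‖util t‖ ≤ 1)
    (hC : ∑ t ∈ Icc 1 T, ‖v t - util t‖ ≤ C) :
    variation T util ≤ 2 * variation T v + 16 * C := by
  refine sum_sq_le_of_perturbed (fun t _ => norm_nonneg _)
    (fun t ht => ⟨norm_nonneg _, (norm_sub_le _ _).trans (by linarith [hv t ht, hu t ht])⟩)
    hC fun t _ => ?_
  have h1 : util t - util (t - 1) = (v t - v (t - 1)) - (v t - util t)
      + (v (t - 1) - util (t - 1)) := by abel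
  rw [h1]
  exact (norm_add_le _ _).trans (add_le_add_left (norm_sub_le _ _) _)

theorem abs_dotProduct_le {d : ℕ} (v w : Fin d → ℝ) : |v ⬝ᵥ w| ≤ l1norm v * ‖w‖ := by
  refine (abs_sum_le_sum_abs _ _).trans ?_
  rw [l1norm, sum_mul]
  refine sum_le_sum fun a _ => ?_
  rw [abs_mul]
  exact mul_le_mul_of_nonneg_left (norm_le_pi_norm w a) (abs_nonneg _)

theorem l1norm_of_mem_stdSimplex {d : ℕ} {p : Fin d → ℝ} (hp : p ∈ stdSimplex ℝ (Fin d)) :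
    l1norm p = 1 := by
  rw [← hp.2]
  exact sum_congr rfl fun a _ => abs_of_nonneg (hp.1 a)

theorem norm_mulVec_sub_le {d : ℕ} {M : Matrix (Fin d) (Fin d) ℝ}
    (hM : M ∈ rowStochastic ℝ (Fin d)) (v : Fin d → ℝ) : ‖M *ᵥ v - v‖ ≤ 2 * ‖v‖ := by
  have h1 : ‖M *ᵥ v‖ ≤ ‖v‖ := by
    refine (pi_norm_le_iff_of_nonneg (norm_nonneg v)).2 fun a => ?_
    have h2 := abs_dotProduct_le (M a) v
    rwa [l1norm_of_mem_stdSimplex ⟨(mem_rowStochastic_iff_sum.1 hM).1 a,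
      (mem_rowStochastic_iff_sum.1 hM).2 a⟩, one_mul] at h2
  exact (norm_sub_le _ _).trans (by linarith)

theorem swapRegretAt_le_of_strategy {d T : ℕ} {x xhat v : ℕ → Fin d → ℝ} {C : ℝ}
    (hv : ∀ t ∈ Icc 1 T, ‖v t‖ ≤ 1) (hC : ∑ t ∈ Icc 1 T, l1norm (x t - xhat t) ≤ C)
    {M : Matrix (Fin d) (Fin d) ℝ} (hM : M ∈ rowStochastic ℝ (Fin d)) :
    swapRegretAt T x v M ≤ swapRegretAt T xhat v M + 2 * C := by
  refine le_trans ?_ (add_le_add_right (mul_le_mul_of_nonneg_left hC zero_le_two) _)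
  rw [swapRegretAt, swapRegretAt, mul_sum, ← sum_add_distrib]
  refine sum_le_sum fun t ht => ?_
  have h1 := (le_abs_self _).trans (abs_dotProduct_le (x t - xhat t) (M *ᵥ v t - v t))
  have h2 : ‖M *ᵥ v t - v t‖ ≤ 2 := (norm_mulVec_sub_le hM (v t)).trans (by linarith [hv t ht])
  have h3 := mul_le_mul_of_nonneg_left h2 (l1norm_nonneg (x t - xhat t))
  rw [sub_dotProduct] at h1
  linarith

theorem swapRegretAt_le_of_utility {d T : ℕ} {x v w : ℕ → Fin d → ℝ} {C : ℝ}
    (hx : ∀ t ∈ Icc 1 T, x t ∈ stdSimplex ℝ (Fin d)) (hC : ∑ t ∈ Icc 1 T, ‖v t - w t‖ ≤ C)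
    {M : Matrix (Fin d) (Fin d) ℝ} (hM : M ∈ rowStochastic ℝ (Fin d)) :
    swapRegretAt T x v M ≤ swapRegretAt T x w M + 2 * C := by
  refine le_trans ?_ (add_le_add_right (mul_le_mul_of_nonneg_left hC zero_le_two) _)
  rw [swapRegretAt, swapRegretAt, mul_sum, ← sum_add_distrib]
  refine sum_le_sum fun t ht => ?_
  have h1 := (le_abs_self _).trans (abs_dotProduct_le (x t) (M *ᵥ (v t - w t) - (v t - w t)))
  have h2 := norm_mulVec_sub_le hM (v t - w t)
  rw [l1norm_of_mem_stdSimplex (hx t ht), one_mul] at h1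
  have h3 : M *ᵥ (v t - w t) - (v t - w t) = (M *ᵥ v t - v t) - (M *ᵥ w t - w t) := by
    rw [mulVec_sub]; abel
  rw [h3, dotProduct_sub] at h1
  rw [h3] at h2
  linarith

theorem swapRegret_le {d T : ℕ} {x v : ℕ → Fin d → ℝ} {B : ℝ}
    (h : ∀ M ∈ rowStochastic ℝ (Fin d), swapRegretAt T x v M ≤ B) : swapRegret T x v ≤ B := by
  obtain ⟨M, hM, hMeq⟩ := (isGreatest_swapRegret T x v).1
  rw [← hMeq]
  exact h M hM

theorem swapRegretAt_one {d : ℕ} (T : ℕ) (x v : ℕ → Fin d → ℝ) : swapRegretAt T x v 1 = 0 := by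
  simp [swapRegretAt]

/-! ### The path length of all players -/

section Game

variable {n T : ℕ} {m : Fin n → ℕ} {u : Fin n → (∀ j, Fin (m j)) → ℝ}
  {xhat x util : ∀ i, ℕ → Fin (m i) → ℝ} {Chat Ctil : Fin n → ℝ}

theorem IsCorruptedPlay.xhat_mem (h : IsCorruptedPlay T u xhat x util Chat Ctil) (i : Fin n) :
    ∀ t ∈ Icc 1 T, xhat i t ∈ stdSimplex ℝ (Fin (m i)) := by
  obtain ⟨Q, hQ⟩ := h.algorithm i
  exact fun t ht => (hQ t ht).2.1

theorem IsCorruptedPlay.norm_util_le (h : IsCorruptedPlay T u xhat x util Chat Ctil) (i : Fin n) :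
    ∀ t ∈ Icc 1 T, ‖util i t‖ ≤ 1 := fun t ht =>
  (pi_norm_le_iff_of_nonneg zero_le_one).2 fun a => abs_le.2 (h.util_mem i t ht a)

theorem IsCorruptedPlay.Chat_nonneg (h : IsCorruptedPlay T u xhat x util Chat Ctil) (i : Fin n) :
    0 ≤ Chat i :=
  (sum_nonneg fun _ _ => l1norm_nonneg _).trans (h.strategy_corruption i)

theorem IsCorruptedPlay.Ctil_nonneg (h : IsCorruptedPlay T u xhat x util Chat Ctil) (i : Fin n) :
    0 ≤ Ctil i :=
  (sum_nonneg fun _ _ => norm_nonneg _).trans (h.utility_corruption i)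

theorem variation_expectedUtilities_le (hu : ∀ i b, u i b ∈ Set.Icc (-1 : ℝ) 1)
    (hx : ∀ i, ∀ t ∈ Icc 1 T, x i t ∈ stdSimplex ℝ (Fin (m i))) (i : Fin n) :
    variation T (expectedUtilities u x i) ≤ n * ∑ j, pathLength T (x j) := by
  simp only [variation, pathLength]
  rw [sum_comm, mul_sum]
  refine sum_le_sum fun t ht => ?_
  rw [mem_Icc] at ht
  have h1 := norm_expectedUtility_sub_le hu
    (fun j => hx j t (mem_Icc.2 ⟨by omega, by omega⟩))
    (fun j => hx j (t - 1) (mem_Icc.2 ⟨by omega, by omega⟩)) i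
  refine (pow_le_pow_left₀ (norm_nonneg _) h1 2).trans ?_
  simpa using sq_sum_le_card_mul_sum_sq (s := univ) (f := fun j => l1norm (x j t - x j (t - 1)))

/-- The utilities of a player vary only as much as the strategies of all players move, up to
corruption. -/
theorem IsCorruptedPlay.expertVariation_le (h : IsCorruptedPlay T u xhat x util Chat Ctil)
    (hn : 2 ≤ n) (hT : 1 ≤ T) (hu : ∀ i b, u i b ∈ Set.Icc (-1 : ℝ) 1) (i : Fin n) :
    expertVariation T (xhat i) (util i)
      ≤ 1 + 9 * (n * ∑ j, pathLength T (xhat j)) + 64 * (n * ∑ j, Chat j) + 32 * Ctil i := by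
  have h1 := SwapRegretGames.expertVariation_le hT (h.norm_util_le i) (h.xhat_mem i)
  have h2 : variation T (util i) ≤ 2 * variation T (expectedUtilities u x i) + 16 * Ctil i :=
    variation_le_of_corruption
      (fun t ht => norm_expectedUtility_le_one hu (fun j => h.strategy_mem j t ht) i)
      (h.norm_util_le i) (h.utility_corruption i)
  have h3 := variation_expectedUtilities_le hu h.strategy_mem i
  have h4 := sum_le_sum fun j (_ : j ∈ univ) => pathLength_le_of_corruption (h.strategy_mem j)
    (h.xhat_mem j) (h.strategy_corruption j)
  rw [sum_add_distrib, ← mul_sum, ← mul_sum] at h4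
  have h5 : pathLength T (xhat i) ≤ ∑ j, pathLength T (xhat j) :=
    single_le_sum (fun j _ => pathLength_nonneg T (xhat j)) (mem_univ i)
  have h6 : (2 : ℝ) ≤ n := by exact_mod_cast hn
  have h7 := mul_le_mul_of_nonneg_left h4 (by linarith : (0 : ℝ) ≤ n)
  have h8 := mul_le_mul_of_nonneg_right h6
    (sum_nonneg fun j (_ : j ∈ univ) => pathLength_nonneg T (xhat j))
  linarith

theorem IsCorruptedPlay.sqrt_expertVariation_le (h : IsCorruptedPlay T u xhat x util Chat Ctil)
    (hn : 2 ≤ n) (hT : 1 ≤ T) (hu : ∀ i b, u i b ∈ Set.Icc (-1 : ℝ) 1) (i : Fin n) :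
    √(expertVariation T (xhat i) (util i))
      ≤ 1 + 3 * √(n * ∑ j, pathLength T (xhat j)) + 8 * √(n * ∑ j, Chat j) + 6 * √(Ctil i) := by
  refine Real.sqrt_le_iff.2 ⟨by positivity, (h.expertVariation_le hn hT hu i).trans ?_⟩
  have e1 := Real.sq_sqrt (mul_nonneg (Nat.cast_nonneg n)
    (sum_nonneg fun j (_ : j ∈ univ) => pathLength_nonneg T (xhat j)) : (0 : ℝ) ≤ _)
  have e2 := Real.sq_sqrt (mul_nonneg (Nat.cast_nonneg n)
    (sum_nonneg fun j (_ : j ∈ univ) => h.Chat_nonneg j) : (0 : ℝ) ≤ _)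
  have e3 := Real.sq_sqrt (h.Ctil_nonneg i)
  set a := √(n * ∑ j, pathLength T (xhat j))
  set b := √(n * ∑ j, Chat j)
  set c := √(Ctil i)
  have ha : 0 ≤ a := Real.sqrt_nonneg _
  have hb : 0 ≤ b := Real.sqrt_nonneg _
  have hc : 0 ≤ c := Real.sqrt_nonneg _
  rw [← e1, ← e2, ← e3]
  nlinarith [mul_nonneg ha hb, mul_nonneg ha hc, mul_nonneg hb hc]

theorem le_maxActions (i : Fin n) : (m i : ℝ) ≤ maxActions m := by
  exact_mod_cast le_sup (f := m) (mem_univ i)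

/-- The path length bound. Swap regret is nonnegative, so the upper bounds on the swap regrets of
all players, weighted by `√(m i)`, add up to a nonnegative number; their negative terms then bound
the path length. The weights turn the factors `1 / √(m i)` of the negative terms into
a common one. -/
theorem IsCorruptedPlay.sqrt_pathLength_le (h : IsCorruptedPlay T u xhat x util Chat Ctil)
    (hn : 2 ≤ n) (hT : 2 ≤ T) (hm : ∀ i, 1 ≤ m i) (hu : ∀ i b, u i b ∈ Set.Icc (-1 : ℝ) 1) :
    √(n * ∑ j, pathLength T (xhat j)) ≤
      70 * (n * (maxActions m * √(maxActions m) * √(Real.log T))) + 2 * √(n * ∑ j, Chat j)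
      + 12 * √(maxActions m * √(maxActions m) * √(Real.log T) * √(n * ∑ j, Ctil j)) := by
  have hn0 : (2 : ℝ) ≤ n := by exact_mod_cast hn
  have hmm : (1 : ℝ) ≤ maxActions m :=
    le_trans (by exact_mod_cast hm ⟨0, by omega⟩) (le_maxActions ⟨0, by omega⟩)
  have hL : 1 / 2 ≤ Real.log T := by
    have h1 : Real.log 2 ≤ Real.log T := Real.log_le_log two_pos (by exact_mod_cast hT)
    linarith [Real.log_two_gt_d9]
  set M : ℝ := (maxActions m : ℝ) with hM
  set L := Real.log T with hLdef
  have hsM : 1 ≤ √M := Real.one_le_sqrt.2 hmm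
  have hsL : 1 / 2 ≤ √L := Real.le_sqrt_of_sq_le (by linarith)
  have hsL2 : √L ^ 2 = L := Real.sq_sqrt (by linarith)
  set c := M * √M * √L with hc
  have hc0 : 1 / 2 ≤ c := by nlinarith [mul_nonneg (by linarith : 0 ≤ M) (by linarith : 0 ≤ √M)]
  have hX0 : 0 ≤ ∑ j, pathLength T (xhat j) := sum_nonneg fun j _ => pathLength_nonneg T (xhat j)
  have hS0 : 0 ≤ ∑ j, Chat j := sum_nonneg fun j _ => h.Chat_nonneg j
  -- the weighted regret bound of player `i`, applied to the identity matrix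
  have hplayer : ∀ i, n / 2 * pathLength T (xhat i)
      ≤ 300 * (n * c ^ 2) + 6 * (c * √(expertVariation T (xhat i) (util i))) := by
    intro i
    have h1 := swapRegretAt_le' hn hT (hm i) (h.algorithm i) (h.norm_util_le i)
      (one_mem (rowStochastic ℝ (Fin (m i))))
    rw [swapRegretAt_one] at h1
    have hd : (1 : ℝ) ≤ m i := by exact_mod_cast hm i
    have hdM : (m i : ℝ) ≤ M := le_maxActions i
    have hsd : 0 < √(m i : ℝ) := Real.sqrt_pos.2 (by linarith)
    have hsdM : √(m i : ℝ) ≤ √M := Real.sqrt_le_sqrt hdM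
    have h2 := mul_le_mul_of_nonneg_left h1 hsd.le
    have e1 : √(m i : ℝ) * (n / (2 * √(m i)) * pathLength T (xhat i))
        = n / 2 * pathLength T (xhat i) := by field_simp
    have e2 : √(m i : ℝ) * (300 * (n * ((m i : ℝ) ^ 2 * √(m i)) * L)) ≤ 300 * (n * c ^ 2) := by
      calc _ = 300 * (n * ((m i * √(m i)) ^ 2 * L)) := by ring
        _ ≤ 300 * (n * ((M * √M) ^ 2 * L)) := by gcongr
        _ = 300 * (n * c ^ 2) := by rw [hc, mul_pow _ (√L), hsL2]
    have e3 : √(m i : ℝ) * (6 * (m i * √(L * expertVariation T (xhat i) (util i))))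
        ≤ 6 * (c * √(expertVariation T (xhat i) (util i))) := by
      rw [Real.sqrt_mul (by linarith)]
      calc _ = 6 * (m i * √(m i) * √L * √(expertVariation T (xhat i) (util i))) := by ring
        _ ≤ 6 * (M * √M * √L * √(expertVariation T (xhat i) (util i))) := by gcongr
    rw [mul_zero, mul_sub, mul_add, e1] at h2
    linarith
  have hsum := sum_le_sum fun i (_ : i ∈ univ) => (hplayer i).trans
    (add_le_add_right (mul_le_mul_of_nonneg_left (mul_le_mul_of_nonneg_left
      (h.sqrt_expertVariation_le hn (by omega) hu i) (by linarith : 0 ≤ c))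
      (by norm_num : (0 : ℝ) ≤ 6)) _)
  have hCS : ∑ i, √(Ctil i) ≤ √(n * ∑ j, Ctil j) := by
    refine Real.le_sqrt_of_sq_le ?_
    have := sq_sum_le_card_mul_sum_sq (s := univ) (f := fun i => √(Ctil i))
    simpa [Real.sq_sqrt (h.Ctil_nonneg _)] using this
  simp only [← mul_sum, sum_add_distrib, sum_const, card_univ, Fintype.card_fin, nsmul_eq_mul]
    at hsum
  have hY := Real.sq_sqrt (mul_nonneg (by linarith : (0 : ℝ) ≤ n) hX0)
  have hy0 := Real.sqrt_nonneg (n * ∑ j, pathLength T (xhat j))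
  have hs0 := Real.sqrt_nonneg (n * ∑ j, Chat j)
  have hg0 := Real.sqrt_nonneg (n * ∑ j, Ctil j)
  set y := √(n * ∑ j, pathLength T (xhat j)) with hy
  set s := √(n * ∑ j, Chat j) with hs
  set σ := √(n * ∑ j, Ctil j) with hσ
  have hG := Real.sq_sqrt (mul_nonneg (by linarith : 0 ≤ c) hg0)
  have hG0 := Real.sqrt_nonneg (c * σ)
  set G := √(c * σ) with hGdef
  set N := n * c with hN
  have hN1 : 1 ≤ N := by nlinarith
  have hquad : y ^ 2 / 2 ≤ 300 * N ^ 2 + 6 * N + 18 * N * y + 48 * N * s + 36 * G ^ 2 := by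
    rw [hY, hG]
    have e1 := mul_le_mul_of_nonneg_left hCS (by linarith : 0 ≤ c)
    have e2 : n / 2 * ∑ j, pathLength T (xhat j) = n * (∑ j, pathLength T (xhat j)) / 2 := by ring
    rw [e2] at hsum
    refine hsum.trans ?_
    have e3 : N ^ 2 = n * (n * c ^ 2) := by rw [hN]; ring
    rw [e3, hN]
    linarith
  -- `18 N y ≤ y² / 4 + 324 N²` and `48 N s ≤ 576 N² + s²`
  have hbound : y ^ 2 ≤ (70 * N + 2 * s + 12 * G) ^ 2 := by
    have hNs : 0 ≤ N * s := mul_nonneg (by linarith) hs0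
    have hNG : 0 ≤ N * G := mul_nonneg (by linarith) hG0
    have hsG : 0 ≤ s * G := mul_nonneg hs0 hG0
    nlinarith [sq_nonneg (y / 2 - 18 * N), sq_nonneg (24 * N - s)]
  exact (sq_le_sq₀ hy0 (by positivity)).1 hbound

/-! ### Swap regret bounds -/

/-- The swap regret of the suggested strategies against the observed utilities. -/
theorem IsCorruptedPlay.swapRegretAt_le (h : IsCorruptedPlay T u xhat x util Chat Ctil)
    (hn : 2 ≤ n) (hT : 2 ≤ T) (hm : ∀ i, 1 ≤ m i) (hu : ∀ i b, u i b ∈ Set.Icc (-1 : ℝ) 1)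
    (i : Fin n) {M : Matrix (Fin (m i)) (Fin (m i)) ℝ} (hM : M ∈ rowStochastic ℝ (Fin (m i))) :
    swapRegretAt T (xhat i) (util i) M ≤
      1566 * (n * ((maxActions m : ℝ) ^ 2 * √(maxActions m)) * Real.log T)
      + 84 * (maxActions m * √(n * (∑ j, Chat j) * Real.log T))
      + 36 * (maxActions m * √(Ctil i * Real.log T))
      + 216 * (maxActions m * √(Real.log T) *
        √(maxActions m * √(maxActions m) * √(Real.log T) * √(n * ∑ j, Ctil j))) := by
  have h1 := swapRegretAt_le' hn hT (hm i) (h.algorithm i) (h.norm_util_le i) hM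
  have h2 := h.sqrt_expertVariation_le hn (by omega) hu i
  have h3 := h.sqrt_pathLength_le hn hT hm hu
  have hn0 : (2 : ℝ) ≤ n := by exact_mod_cast hn
  have hd : (1 : ℝ) ≤ m i := by exact_mod_cast hm i
  have hdM : (m i : ℝ) ≤ maxActions m := le_maxActions i
  have hL : 1 / 2 ≤ Real.log T := by
    have h1 : Real.log 2 ≤ Real.log T := Real.log_le_log two_pos (by exact_mod_cast hT)
    linarith [Real.log_two_gt_d9]
  have hS0 : 0 ≤ ∑ j, Chat j := sum_nonneg fun j _ => h.Chat_nonneg j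
  set m' : ℝ := (maxActions m : ℝ) with hm'
  set L := Real.log T with hLdef
  set X := pathLength T (xhat i)
  have hX : 0 ≤ X := pathLength_nonneg _ _
  have hsM : 1 ≤ √m' := Real.one_le_sqrt.2 (hd.trans hdM)
  have hsL : 1 / 2 ≤ √L := Real.le_sqrt_of_sq_le (by linarith)
  have hsL2 : √L ^ 2 = L := Real.sq_sqrt (by linarith)
  have hX' : 0 ≤ n / (2 * √(m i : ℝ)) * X := by positivity
  rw [Real.sqrt_mul (by linarith : 0 ≤ L)] at h1
  rw [Real.sqrt_mul (mul_nonneg (by linarith) hS0), Real.sqrt_mul (h.Ctil_nonneg i)]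
  have h4 : (300 : ℝ) * (n * ((m i : ℝ) ^ 2 * √(m i)) * L) ≤ 300 * (n * (m' ^ 2 * √m') * L) := by
    gcongr
  set P := √(expertVariation T (xhat i) (util i))
  set N := n * (m' * √m' * √L) with hN
  have hN1 : 1 ≤ N := by
    have e1 : 1 ≤ m' * √m' := by nlinarith
    have e2 : 1 / 2 ≤ m' * √m' * √L := by nlinarith
    rw [hN]; nlinarith
  set s := √(n * ∑ j, Chat j)
  set G := √(m' * √m' * √L * √(n * ∑ j, Ctil j))
  have h5 : P ≤ 211 * N + 14 * s + 36 * G + 6 * √(Ctil i) := by linarith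
  have h6 : (m i : ℝ) * (√L * P) ≤ m' * (√L * (211 * N + 14 * s + 36 * G + 6 * √(Ctil i))) :=
    mul_le_mul hdM (mul_le_mul_of_nonneg_left h5 (by linarith)) (by positivity) (by linarith)
  have h7 : m' * (√L * N) = n * (m' ^ 2 * √m') * L := by
    rw [hN]; linear_combination (n * m' ^ 2 * √m') * hsL2
  linarith

end Game

end SwapRegretGames

end

open SwapRegretGames

theorem mainTheorem2 :
    ∃ K : ℝ, 0 < K ∧
      ∀ (n T : ℕ) (_hn : 2 ≤ n) (_hT : 2 ≤ T)
        (m : Fin n → ℕ) (_hm : ∀ i, 1 ≤ m i)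
        (u : Fin n → (∀ j, Fin (m j)) → ℝ) (_hu : ∀ i b, u i b ∈ Set.Icc (-1 : ℝ) 1)
        (xhat x util : ∀ i, ℕ → Fin (m i) → ℝ) (Chat Ctil : Fin n → ℝ)
        (_hplay : SwapRegretGames.IsCorruptedPlay T u xhat x util Chat Ctil) (i : Fin n),
        let mmax : ℝ := (SwapRegretGames.maxActions m : ℝ)
        let Shat : ℝ := ∑ j, Chat j
        let Stil : ℝ := ∑ j, Ctil j
        SwapRegretGames.swapRegret T (x i) (SwapRegretGames.expectedUtilities u x i) ≤
            K * (n * mmax ^ (5 / 2 : ℝ) * Real.log T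
              + min (mmax * √((Shat * (n + √mmax) + Stil * √mmax) * Real.log T))
                  (m i * √(T * Real.log T))
              + (2 * Chat i + 2 * Ctil i)) ∧
        SwapRegretGames.swapRegret T (x i) (util i) ≤
            K * (n * mmax ^ (5 / 2 : ℝ) * Real.log T
              + min (mmax * √((Shat * (n + √mmax) + Ctil i) * Real.log T)
                    + (Stil * n * mmax ^ 7 * Real.log T ^ 3) ^ (1 / 4 : ℝ))
                  (m i * √(T * Real.log T))
              + Chat i) := by
  refine ⟨2000, by norm_num, ?_⟩
  intro n T hn hT m hm u hu xhat x util Chat Ctil h i mmax Shat Stil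
  have hn0 : (2 : ℝ) ≤ n := by exact_mod_cast hn
  have hd : (1 : ℝ) ≤ m i := by exact_mod_cast hm i
  have hdM : (m i : ℝ) ≤ mmax := le_maxActions i
  have hmm : 1 ≤ mmax := hd.trans hdM
  have hL : 1 / 2 ≤ Real.log T := by
    have h1 : Real.log 2 ≤ Real.log T := Real.log_le_log two_pos (by exact_mod_cast hT)
    linarith [Real.log_two_gt_d9]
  have hsM : 1 ≤ √mmax := Real.one_le_sqrt.2 hmm
  have hS0 : 0 ≤ Shat := sum_nonneg fun j _ => h.Chat_nonneg j
  have hSt0 : 0 ≤ Stil := sum_nonneg fun j _ => h.Ctil_nonneg j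
  have hCh := h.Chat_nonneg i
  have hCt := h.Ctil_nonneg i
  have hCtS : Ctil i ≤ Stil := single_le_sum (fun j _ => h.Ctil_nonneg j) (mem_univ i)
  have hpow : mmax ^ (5 / 2 : ℝ) = mmax ^ 2 * √mmax := by
    rw [show (5 / 2 : ℝ) = (2 : ℕ) + 1 / 2 by norm_num, Real.rpow_add (by linarith),
      Real.rpow_natCast, Real.sqrt_eq_rpow]
  rw [hpow]
  set L := Real.log T with hLdef
  set E := n * (mmax ^ 2 * √mmax) * L with hE
  have hE0 : 0 ≤ E := by positivity
  set G := mmax * √L * √(mmax * √mmax * √L * √(n * Stil)) with hG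
  have hsL2 : √L ^ 2 = L := Real.sq_sqrt (by linarith)
  -- the bound that holds without any relation between the players
  have hworst : ∀ M ∈ rowStochastic ℝ (Fin (m i)),
      swapRegretAt T (xhat i) (util i) M ≤ 300 * E + 12 * (m i * √(T * L)) := by
    intro M hM
    have h1 := swapRegretAt_le' hn hT (hm i) (h.algorithm i) (h.norm_util_le i) hM
    have h2 : 0 ≤ n / (2 * √(m i : ℝ)) * pathLength T (xhat i) :=
      mul_nonneg (by positivity) (pathLength_nonneg _ _)
    have h3 : (300 : ℝ) * (n * ((m i : ℝ) ^ 2 * √(m i)) * L) ≤ 300 * E := by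
      rw [hE]; gcongr
    have h4 : √(L * expertVariation T (xhat i) (util i)) ≤ 2 * √(T * L) := by
      have e1 := expertVariation_le_mul (h.norm_util_le i) (h.xhat_mem i)
      refine Real.sqrt_le_iff.2 ⟨by positivity, ?_⟩
      rw [mul_pow, Real.sq_sqrt (by positivity)]
      nlinarith [mul_le_mul_of_nonneg_left e1 (by linarith : 0 ≤ L)]
    have h5 := mul_le_mul_of_nonneg_left h4 (by linarith : (0 : ℝ) ≤ m i)
    linarith
  have hgame : ∀ M ∈ rowStochastic ℝ (Fin (m i)), swapRegretAt T (xhat i) (util i) M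
      ≤ 1566 * E + 84 * (mmax * √(n * Shat * L)) + 36 * (mmax * √(Ctil i * L)) + 216 * G :=
    fun M hM => h.swapRegretAt_le hn hT hm hu i hM
  have hSn : n * Shat ≤ Shat * (n + √mmax) := by
    nlinarith [mul_nonneg hS0 (by linarith : 0 ≤ √mmax)]
  have hmono : ∀ {a b : ℝ}, a ≤ b → mmax * √(a * L) ≤ mmax * √(b * L) := fun hab => by
    have : 0 ≤ L := by linarith
    gcongr
  constructor
  · set B := mmax * √((Shat * (n + √mmax) + Stil * √mmax) * L) with hB
    have hStM : Stil ≤ Stil * √mmax := le_mul_of_one_le_right hSt0 hsM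
    have hSM : 0 ≤ Shat * (n + √mmax) := by positivity
    have e1 : mmax * √(n * Shat * L) ≤ B := hmono (by nlinarith)
    have e2 : mmax * √(Ctil i * L) ≤ B := hmono (by linarith)
    have e3 : mmax * √(Stil * L) ≤ B := hmono (by linarith)
    -- `√(c √(n S)) ≤ n c + √S`, so the mixed term is dominated by the other two
    have e4 : G ≤ E + B := by
      have f1 : √(mmax * √mmax * √L * √(n * Stil)) ≤ n * (mmax * √mmax * √L) + √Stil := by
        refine Real.sqrt_le_iff.2 ⟨by positivity, ?_⟩
        have g1 : √(n : ℝ) ≤ n := Real.sqrt_le_iff.2 ⟨by linarith, by nlinarith⟩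
        have g2 : 0 ≤ mmax * √mmax * √L := by positivity
        rw [Real.sqrt_mul (by linarith)]
        have g3 : mmax * √mmax * √L * (√(n : ℝ) * √Stil)
            ≤ mmax * √mmax * √L * (n * √Stil) := by gcongr
        have g4 : 0 ≤ n * (mmax * √mmax * √L) * √Stil := by positivity
        nlinarith [sq_nonneg (n * (mmax * √mmax * √L)), sq_nonneg (√Stil)]
      have f2 : mmax * √L * (n * (mmax * √mmax * √L)) = E := by
        rw [hE]; linear_combination (n * mmax ^ 2 * √mmax) * hsL2
      have f3 : mmax * √L * √Stil = mmax * √(Stil * L) := by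
        rw [Real.sqrt_mul hSt0]; ring
      calc G ≤ mmax * √L * (n * (mmax * √mmax * √L) + √Stil) := by rw [hG]; gcongr
        _ = E + mmax * √(Stil * L) := by rw [mul_add, f2, f3]
        _ ≤ E + B := by linarith
    have hB0 : 0 ≤ B := by positivity
    have hW0 : 0 ≤ m i * √(T * L) := by positivity
    refine swapRegret_le fun M hM => ?_
    have h1 := swapRegretAt_le_of_utility (h.strategy_mem i) (h.utility_corruption i) hM
    have h2 := swapRegretAt_le_of_strategy (h.norm_util_le i) (h.strategy_corruption i) hM
    have h3 := hgame M hM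
    have h4 := hworst M hM
    rcases min_choice B (m i * √(T * L)) with hmin | hmin <;> rw [hmin] <;> linarith
  · set B := mmax * √((Shat * (n + √mmax) + Ctil i) * L) with hB
    have hSM : 0 ≤ Shat * (n + √mmax) := by positivity
    have e1 : mmax * √(n * Shat * L) ≤ B := hmono (by linarith)
    have e2 : mmax * √(Ctil i * L) ≤ B := hmono (by linarith)
    have e3 : (Stil * n * mmax ^ 7 * L ^ 3) ^ (1 / 4 : ℝ) = G := by
      have f1 : G ^ 4 = Stil * n * mmax ^ 7 * L ^ 3 := by
        have g1 : √(mmax * √mmax * √L * √(n * Stil)) ^ 4 = mmax ^ 3 * L * (n * Stil) := by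
          rw [show (4 : ℕ) = 2 * 2 from rfl, pow_mul, Real.sq_sqrt (by positivity), mul_pow,
            mul_pow, mul_pow, Real.sq_sqrt (by linarith : 0 ≤ mmax), hsL2,
            Real.sq_sqrt (by positivity)]
          ring
        have g2 : √L ^ 4 = L ^ 2 := by rw [show (4 : ℕ) = 2 * 2 from rfl, pow_mul, hsL2]
        rw [hG, mul_pow, mul_pow, g1, g2]
        ring
      have f2 : 0 ≤ G := by positivity
      rw [← f1, show (1 / 4 : ℝ) = ((4 : ℕ) : ℝ)⁻¹ by norm_num,
        Real.pow_rpow_inv_natCast f2 (by norm_num)]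
    rw [e3]
    have hB0 : 0 ≤ B := by positivity
    have hG0 : 0 ≤ G := by positivity
    have hW0 : 0 ≤ m i * √(T * L) := by positivity
    refine swapRegret_le fun M hM => ?_
    have h2 := swapRegretAt_le_of_strategy (h.norm_util_le i) (h.strategy_corruption i) hM
    have h3 := hgame M hM
    have h4 := hworst M hM
    rcases min_choice (B + G) (m i * √(T * L)) with hmin | hmin <;> rw [hmin] <;> linarith
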